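/- Let $\mathbb T=\{\zeta\in\mathbb C:|\zeta|=1\}$ with normalized Lebesgue measure $m$, let $L^q=L^q(\mathbb T,m)$ for $0<q\le\infty$, and let $H^q\subset L^q$ be the Hardy space, i.e. the set of nontangential boundary functions of holomorphic $F$ on the unit disk with $\sup_{0<r<1}\|F(r\,\cdot)\|_{L^q}<\infty$. For $\varphi\in L^\infty$ and $f\in H^1$ put $T_\varphi f=P_+(\varphi f)$, where $P_+$ discards the Fourier coefficients with negative index, and for $1\le p\le\infty$ let $K_p(\varphi)=\{f\in H^p: T_\varphi f=0\}$. For $w\ge 0$ with $\log w\in L^1$ let $\mathcal O_w=\exp\{\log w+i\mathcal H(\log w)\}$, where $\mathcal H$ is the harmonic conjugation operator; the functions $\lambda\mathcal O_w$ with such $w$ and $|\lambda|=1$ are called outer. An inner function is a function in $H^\infty$ of modulus $1$ a.e. on $\mathbb T$; an inner function $J$ is an inner divisor of an inner function $I$ if $I/J$ is inner; the inner factor of $\mathcal G$ is the inner function $I$ (unique up to a unimodular constant) for which $\mathcal G/I$ is outer. **Theorem.** Let $1\le p\le\infty$, and let $\varphi\in L^\infty$ be a non-null function for which $K_p(\varphi)\neq\{0\}$.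 Let $g\in L^{p/2}$ be nonnegative (with $p/2=\infty$ if $p=\infty$). Then the following conditions are equivalent: (i) there is an $f\in K_p(\varphi)$ such that $|f|^2=g$ a.e. on $\mathbb T$; (ii) $\bar z\,\bar\varphi\, g\in H^{p/2}$ (where $z$ denotes the coordinate function on $\mathbb T$). Moreover, suppose that (ii) holds and $g$ is non-null. Then $\log\sqrt g\in L^1$ and $\bar z\bar\varphi g$ has an inner factor. If $I$ is the inner factor of $\bar z\bar\varphi g$, then a function $f$ on $\mathbb T$ satisfies $f\in K_p(\varphi)$ and $|f|^2=g$ a.e. if and only if $f=\mathcal O_{\sqrt g}\,J$ a.e. for some inner divisor $J$ of $I$. -/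

import Mathlib

open MeasureTheory Filter Topology Metric
open scoped ENNReal ComplexConjugate Real

noncomputable section

namespace ToeplitzKernel

instance factTwoPiPos : Fact (0 < 2 * π) := ⟨Real.two_pi_pos⟩

/-- The unit circle, parametrized by `t ↦ e^{it}`, `t ∈ ℝ / 2πℤ`. -/
abbrev Torus : Type := AddCircle (2 * π)

/-- Normalized Lebesgue measure on the unit circle. -/
abbrev m : Measure Torus := AddCircle.haarAddCircle

/-- The coordinate function: the point `e^{it}` of the unit circle in `ℂ`. -/
def pt (t : Torus) : ℂ := (AddCircle.toCircle t : ℂ)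

/-- The nontangential approach region (Stolz angle) of aperture `α` at a point `ζ` of the
unit circle. -/
def stolz (α : ℝ) (ζ : ℂ) : Set ℂ := {z | ‖z‖ < 1 ∧ ‖z - ζ‖ < α * (1 - ‖z‖)}

/-- The filter of nontangential approach to `ζ`: a function has limit `a` along it if and only if,
for every aperture `α`, it tends to `a` as `z → ζ` inside `stolz α ζ`. -/
def nontangential (ζ : ℂ) : Filter ℂ := ⨆ α : ℝ, 𝓝[stolz α ζ] ζ

/-- `F` belongs to the Hardy space `H^p` of the unit disk (`0 < p ≤ ∞`): it is holomorphic and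
the `L^p` (quasi)norms of its dilations `ζ ↦ F (r ζ)`, `0 < r < 1`, are bounded. -/
def MemHardyDisk (p : ℝ≥0∞) (F : ℂ → ℂ) : Prop :=
  DifferentiableOn ℂ F (ball 0 1) ∧
    ⨆ r ∈ Set.Ioo (0 : ℝ) 1, eLpNorm (fun t : Torus => F ((r : ℂ) * pt t)) p m < ∞

/-- The Hardy space `H^p` of the circle: the functions that agree a.e. with the nontangential
boundary values of some function in `H^p` of the disk. -/
def Hardy (p : ℝ≥0∞) : Set (Torus → ℂ) :=
  {f | ∃ F : ℂ → ℂ, MemHardyDisk p F ∧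
    ∀ᵐ t ∂m, Tendsto F (nontangential (pt t)) (𝓝 (f t))}

/-- `P₊ h` for `h ∈ L¹`, as a holomorphic function on the disk: the negative-indexed Fourier
coefficients of `h` are discarded. -/
def rieszProj (h : Torus → ℂ) (z : ℂ) : ℂ := ∑' n : ℕ, fourierCoeff h (n : ℤ) * z ^ n

/-- The Toeplitz operator `T_φ f = P₊ (φ f)`, its values being read as functions on the disk. -/
def toeplitz (φ f : Torus → ℂ) : ℂ → ℂ := rieszProj (fun t => φ t * f t)

/-- The Toeplitz kernel `K_p(φ) = {f ∈ H^p : T_φ f = 0}`. -/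
def toeplitzKer (p : ℝ≥0∞) (φ : Torus → ℂ) : Set (Torus → ℂ) :=
  {f | f ∈ Hardy p ∧ ∀ z ∈ ball (0 : ℂ) 1, toeplitz φ f z = 0}

/-- The conjugate Poisson integral of `u`:
`z ↦ ∫ Im ((ζ + z) / (ζ - z)) u(ζ) dm(ζ)`. -/
def conjPoisson (u : Torus → ℝ) (z : ℂ) : ℝ :=
  ∫ t, ((pt t + z) / (pt t - z)).im * u t ∂m

/-- The harmonic conjugation operator: the boundary function of the conjugate Poisson integral
(for `u ∈ L¹` the nontangential limit exists a.e.). -/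
def harmConj (u : Torus → ℝ) (t : Torus) : ℝ := limUnder (nontangential (pt t)) (conjPoisson u)

/-- The weights that have an outer function: `w > 0` a.e. and `log w ∈ L¹` (a nonnegative `w`
with `log w ∈ L¹` in the usual sense, `log 0 = -∞`, is positive a.e.). -/
def LogIntegrable (w : Torus → ℝ) : Prop :=
  (∀ᵐ t ∂m, 0 < w t) ∧ Integrable (fun t => Real.log (w t)) m

/-- The outer function `O_w = exp (log w + i H(log w))` on the circle. -/
def outerFn (w : Torus → ℝ) (t : Torus) : ℂ :=
  Complex.exp ((Real.log (w t) : ℂ) + Complex.I * (harmConj (fun s => Real.log (w s)) t : ℂ))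

/-- Outer functions: `λ O_w` with `|λ| = 1` and `log w ∈ L¹`. -/
def IsOuter (h : Torus → ℂ) : Prop :=
  ∃ c : ℂ, ‖c‖ = 1 ∧ ∃ w : Torus → ℝ, LogIntegrable w ∧ h =ᵐ[m] fun t => c * outerFn w t

/-- Inner functions: `H^∞` functions of modulus `1` a.e. on the circle. -/
def IsInner (h : Torus → ℂ) : Prop := h ∈ Hardy ∞ ∧ ∀ᵐ t ∂m, ‖h t‖ = 1

/-- `I` is the inner factor of `G` (determined up to a unimodular constant): `I` is inner and
`G = I O` with `O` outer. -/
def IsInnerFactor (I G : Torus → ℂ) : Prop :=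
  IsInner I ∧ ∃ O : Torus → ℂ, IsOuter O ∧ G =ᵐ[m] fun t => I t * O t

/-- `J` is an inner divisor of `I`: `J` is inner and `I = J J'` for some inner `J'`. -/
def IsInnerDivisor (J I : Torus → ℂ) : Prop :=
  IsInner J ∧ ∃ J' : Torus → ℂ, IsInner J' ∧ I =ᵐ[m] fun t => J t * J' t

end ToeplitzKernel

end

/-!
Write `G = z̄ φ̄ g`. Discarding Fourier coefficients turns `T_φ f = 0` into a statement about
boundary functions: `f ∈ K_p(φ)` if and only if both `f` and `k = z̄ φ̄ f̄` lie in `H^p`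
(`mem_toeplitzKer_iff`). If moreover `|f|² = g`, then `G = k f`, a product of two `H^p` functions,
so that `G ∈ H^{p/2}`. Conversely, a nonzero member of the kernel and its companion `k` have
log-integrable moduli, hence so has `φ` (`logIntegrable_symbol`), and if `G = I O` with `I` inner and
`O` outer, then `g` has log-integrable modulus too and `O` is a unimodular multiple of
`O_{|φ| √g} O_{√g}`. Comparing inner factors in `G = k f` shows that the inner factor `J` of `f`
divides `I`, and that each divisor `J` of `I` produces a member `O_{√g} J` of the kernel, its
companion having inner factor `I / J` (`mem_toeplitzKer_iff_exists_isInnerDivisor`).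

What this rests on is inner-outer factorization in `H^q` for all `q > 0`
(`exists_inner_of_mem_hardy`), obtained without Blaschke products. For `F ∈ H^q` with boundary
function `f ≠ 0`, one has `log |f| ∈ L¹` and `log |F| ≤ P[log |f|]`, where `P` is the Poisson integral
(`MemHardyDisk.norm_le_exp_poisson_log`); so `F` divided by the outer function of modulus `|f|` is
bounded by `1`, with boundary values of modulus `1`. The factorization also gives Smirnov's theorem
(a Hardy function lying in `L^q` is in `H^q`) and the stability of Hardy functions under products.

Boundary values come from Fatou's theorem for Poisson integrals at Lebesgue points
(`ae_tendsto_poisson`). A bounded holomorphic function is a Poisson integral by weak compactness in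
`L²`, so it has nontangential limits. Applied to `1 / (1 + H)`, where `H` is the Herglotz integral of a
nonnegative function, this yields the nontangential limits of conjugate Poisson integrals
(`ae_tendsto_conjPoisson`), so that outer functions on the circle are the boundary functions of outer
functions on the disk.
-/

namespace ToeplitzKernel


/-! ### The circle and nontangential approach -/

@[fun_prop] lemma continuous_pt : Continuous pt :=
  continuous_subtype_val.comp AddCircle.continuous_toCircle

@[simp] lemma norm_pt (t : Torus) : ‖pt t‖ = 1 := Circle.norm_coe _

lemma pt_ne_zero (t : Torus) : pt t ≠ 0 := Circle.coe_ne_zero _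

lemma pt_mem_sphere (t : Torus) : pt t ∈ sphere (0 : ℂ) 1 := by simp

lemma pt_coe (x : ℝ) : pt (x : Torus) = Complex.exp (x * Complex.I) := by
  simp [pt, AddCircle.toCircle_apply_mk, Circle.coe_exp]

lemma conj_pt (t : Torus) : conj (pt t) = (pt t)⁻¹ := by
  rw [Complex.inv_def, Complex.normSq_eq_norm_sq]; simp

lemma fourier_eq_pt_zpow (n : ℤ) (t : Torus) : (fourier n t : ℂ) = pt t ^ n := by
  rw [fourier_apply, AddCircle.toCircle_zsmul, pt, Circle.coe_zpow]

/-- The integral over the circle as a circle average. -/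
lemma integral_comp_pt {E : Type*} [NormedAddCommGroup E] [NormedSpace ℝ E] (f : ℂ → E) :
    ∫ t, f (pt t) ∂m = Real.circleAverage f 0 1 := by
  rw [AddCircle.integral_haarAddCircle, Real.circleAverage_def,
    ← AddCircle.intervalIntegral_preimage (2 * π) 0]
  simp [pt_coe, circleMap]

/-- A chord is at least `2 / π` times the arc it subtends. -/
lemma dist_le_norm_pt_sub (s t : Torus) : 2 / π * dist s t ≤ ‖pt s - pt t‖ := by
  have h1 : ‖pt s - pt t‖ = ‖pt (s - t) - 1‖ := by
    have : pt s - pt t = (pt (s - t) - 1) * pt t := by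
      have : pt s = pt (s - t) * pt t := by
        rw [pt, pt, pt, ← Circle.coe_mul, ← AddCircle.toCircle_add]; simp
      rw [this]; ring
    rw [this]; simp
  rw [h1, dist_eq_norm]
  generalize s - t = u
  obtain ⟨x, hx, rfl⟩ : ∃ x : ℝ, |x| ≤ π ∧ (x : Torus) = u := by
    induction u using QuotientAddGroup.induction_on with
    | H y =>
      refine ⟨y - round ((2 * π)⁻¹ * y) * (2 * π), ?_, ?_⟩
      · have := AddCircle.norm_eq (p := 2 * π) (x := y)
        rw [← this]
        have h2 := AddCircle.norm_le_half_period (2 * π) (x := (y : Torus)) (by positivity)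
        rw [abs_of_pos Real.two_pi_pos] at h2
        linarith
      · rw [AddCircle.coe_sub, sub_eq_self]
        exact (AddCircle.coe_eq_zero_iff _).2 ⟨round ((2 * π)⁻¹ * y), by simp⟩
  have hn : ‖(x : Torus)‖ = |x| := by
    apply AddCircle.norm_coe_eq_abs_iff (2 * π) (by positivity) |>.2
    rw [abs_of_pos Real.two_pi_pos]; linarith
  rw [hn, pt_coe, mul_comm (x : ℂ), Complex.norm_exp_I_mul_ofReal_sub_one, Real.norm_eq_abs,
    abs_mul, abs_two]
  have h3 : 2 / π * (|x| / 2) ≤ Real.sin (|x| / 2) :=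
    Real.mul_le_sin (by positivity) (by linarith)
  have h4 : Real.sin (|x| / 2) ≤ |Real.sin (x / 2)| := by
    rcases abs_cases x with ⟨h, _⟩ | ⟨h, _⟩
    · rw [h]; exact le_abs_self _
    · rw [h, neg_div, Real.sin_neg]; exact neg_le_abs _
  linarith

lemma mul_pt_mem_ball {r : ℝ} (hr : r ∈ Set.Ioo (0 : ℝ) 1) (t : Torus) :
    (r : ℂ) * pt t ∈ ball (0 : ℂ) 1 := by
  simp [abs_of_pos hr.1, hr.2]

/-- Radial approach is nontangential. -/
lemma tendsto_radial (t : Torus) :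
    Tendsto (fun r : ℝ => (r : ℂ) * pt t) (𝓝[<] 1) (nontangential (pt t)) := by
  refine Tendsto.mono_right ?_ (le_iSup (fun α : ℝ => 𝓝[stolz α (pt t)] (pt t)) 2)
  refine tendsto_nhdsWithin_iff.2 ⟨?_, ?_⟩
  · have : Tendsto (fun r : ℝ => (r : ℂ) * pt t) (𝓝 1) (𝓝 (((1 : ℝ) : ℂ) * pt t)) :=
      (Complex.continuous_ofReal.mul continuous_const).tendsto _
    simpa using this.mono_left nhdsWithin_le_nhds
  · filter_upwards [Ioo_mem_nhdsLT (zero_lt_one' ℝ)] with r hr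
    have h : (r : ℂ) * pt t - pt t = ((r - 1 : ℝ) : ℂ) * pt t := by push_cast; ring
    simp only [stolz, Set.mem_ofPred_eq, h, norm_mul, norm_pt, Complex.norm_real, mul_one,
      Real.norm_eq_abs, abs_of_pos hr.1]
    rw [abs_of_neg (by linarith [hr.2])]
    exact ⟨hr.2, by linarith [hr.2]⟩

instance nontangential_neBot (t : Torus) : (nontangential (pt t)).NeBot :=
  (tendsto_radial t).neBot

lemma ball_mem_nontangential (ζ : ℂ) : ball (0 : ℂ) 1 ∈ nontangential ζ := by
  refine mem_iSup.2 fun α => mem_of_superset self_mem_nhdsWithin fun z hz => ?_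
  simpa using hz.1

lemma tendsto_nontangential_iff {X : Type*} {F : ℂ → X} {ζ : ℂ} {l : Filter X} :
    Tendsto F (nontangential ζ) l ↔ ∀ α, Tendsto F (𝓝[stolz α ζ] ζ) l :=
  tendsto_iSup

/-- The radii `1 - 1 / (n + 2)`, increasing to `1` inside `(0, 1)`. -/
noncomputable def radius (n : ℕ) : ℝ := 1 - 1 / (n + 2)

lemma radius_mem (n : ℕ) : radius n ∈ Set.Ioo (0 : ℝ) 1 := by
  have h : (0 : ℝ) < n + 2 := by positivity
  have : 1 / ((n : ℝ) + 2) < 1 := by rw [div_lt_one h]; linarith [n.cast_nonneg (α := ℝ)]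
  exact ⟨by rw [radius]; linarith, by rw [radius]; linarith [one_div_pos.2 h]⟩

lemma tendsto_radius : Tendsto radius atTop (𝓝[<] 1) := by
  refine tendsto_nhdsWithin_iff.2 ⟨?_, Eventually.of_forall fun n => (radius_mem n).2⟩
  have : Tendsto (fun n : ℕ => 1 / ((n : ℝ) + 2)) atTop (𝓝 0) :=
    tendsto_const_nhds.div_atTop (tendsto_atTop_add_const_right _ _ tendsto_natCast_atTop_atTop)
  have h := this.const_sub 1
  rw [sub_zero] at h
  exact h

lemma tendsto_radius_mul (z : ℂ) : Tendsto (fun n => (radius n : ℂ) * z) atTop (𝓝 z) := by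
  have := (Complex.continuous_ofReal.tendsto 1).comp
    (tendsto_radius.mono_right nhdsWithin_le_nhds)
  simpa using this.mul_const z

lemma differentiableOn_dilate {F : ℂ → ℂ} (hF : DifferentiableOn ℂ F (ball 0 1)) {r : ℝ}
    (hr : r ∈ Set.Ioo (0 : ℝ) 1) :
    DifferentiableOn ℂ (fun z => F (r * z)) (closedBall 0 1) := by
  refine hF.comp (by fun_prop) fun z hz => ?_
  simp only [mem_closedBall, dist_zero_right] at hz
  simp only [mem_ball, dist_zero_right, norm_mul, Complex.norm_real, Real.norm_eq_abs,
    abs_of_pos hr.1]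
  nlinarith [hr.1, hr.2, norm_nonneg z]

lemma diffContOnCl_dilate {F : ℂ → ℂ} (hF : DifferentiableOn ℂ F (ball 0 1)) {r : ℝ}
    (hr : r ∈ Set.Ioo (0 : ℝ) 1) : DiffContOnCl ℂ (fun z => F (r * z)) (ball 0 1) := by
  apply DifferentiableOn.diffContOnCl
  rw [closure_ball 0 one_ne_zero]
  exact differentiableOn_dilate hF hr

lemma continuous_dilate {F : ℂ → ℂ} (hF : DifferentiableOn ℂ F (ball 0 1)) {r : ℝ}
    (hr : r ∈ Set.Ioo (0 : ℝ) 1) : Continuous fun t : Torus => F (r * pt t) :=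
  hF.continuousOn.comp_continuous (by fun_prop)
    fun t => mul_pt_mem_ball hr t

lemma tendsto_dilate {F : ℂ → ℂ} {t : Torus} {a : ℂ}
    (h : Tendsto F (nontangential (pt t)) (𝓝 a)) :
    Tendsto (fun n => F (radius n * pt t)) atTop (𝓝 a) :=
  h.comp ((tendsto_radial t).comp tendsto_radius)

lemma aestronglyMeasurable_boundary {F : ℂ → ℂ} (hF : DifferentiableOn ℂ F (ball 0 1))
    {f : Torus → ℂ} (hf : ∀ᵐ t ∂m, Tendsto F (nontangential (pt t)) (𝓝 (f t))) :
    AEStronglyMeasurable f m :=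
  aestronglyMeasurable_of_tendsto_ae atTop
    (fun n => (continuous_dilate hF (radius_mem n)).aestronglyMeasurable)
    (hf.mono fun _ ht => tendsto_dilate ht)

/-! ### The Poisson kernel -/

/-- The Poisson kernel of the disk, `Re ((ζ + z) / (ζ - z))` at `ζ = e^{it}`. -/
noncomputable def pk (z : ℂ) (t : Torus) : ℝ := ((pt t + z) / (pt t - z)).re

/-- The Poisson integral of `u` at `z`. -/
noncomputable def poisson {E : Type*} [NormedAddCommGroup E] [NormedSpace ℝ E] (u : Torus → E)
    (z : ℂ) : E := ∫ t, pk z t • u t ∂m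

lemma pt_sub_ne_zero {z : ℂ} (hz : z ∈ ball (0 : ℂ) 1) (t : Torus) : pt t - z ≠ 0 := by
  intro h
  rw [sub_eq_zero] at h
  simp [← h] at hz

lemma continuous_herglotzKernel {z : ℂ} (hz : z ∈ ball (0 : ℂ) 1) :
    Continuous fun t : Torus => (pt t + z) / (pt t - z) :=
  (continuous_pt.add continuous_const).div (continuous_pt.sub continuous_const) (pt_sub_ne_zero hz)

lemma continuous_pk {z : ℂ} (hz : z ∈ ball (0 : ℂ) 1) : Continuous (pk z) :=
  Complex.continuous_re.comp (continuous_herglotzKernel hz)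

lemma pk_eq (z : ℂ) (t : Torus) : pk z t = (1 - ‖z‖ ^ 2) / ‖pt t - z‖ ^ 2 := by
  have := congrFun (poissonKernel_eq_re_herglotzRieszKernel (c := 0) (w := z)) (pt t)
  simp only [poissonKernel_def, Function.comp, herglotzRieszKernel_def, sub_zero, norm_pt,
    one_pow] at this
  exact this.symm

lemma pk_pos {z : ℂ} (hz : z ∈ ball (0 : ℂ) 1) (t : Torus) : 0 < pk z t := by
  rw [pk_eq]
  have h1 := norm_pos_iff.2 (pt_sub_ne_zero hz t)
  simp only [mem_ball, dist_zero_right] at hz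
  have : 0 < 1 - ‖z‖ ^ 2 := by nlinarith [norm_nonneg z]
  positivity

lemma pk_le {z : ℂ} (hz : z ∈ ball (0 : ℂ) 1) (t : Torus) : pk z t ≤ (1 + ‖z‖) / (1 - ‖z‖) := by
  simpa [pk] using re_herglotzRieszKernel_le (c := 0) (pt_mem_sphere t) hz

lemma le_pk {z : ℂ} (hz : z ∈ ball (0 : ℂ) 1) (t : Torus) : (1 - ‖z‖) / (1 + ‖z‖) ≤ pk z t := by
  simpa [pk] using le_re_herglotzRieszKernel (c := 0) (pt_mem_sphere t) hz

/-- The **Poisson formula** on the closed disk. -/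
lemma poisson_of_diffContOnCl {G : ℂ → ℂ} (hG : DiffContOnCl ℂ G (ball 0 1)) {z : ℂ}
    (hz : z ∈ ball (0 : ℂ) 1) : poisson (fun t => G (pt t)) z = G z := by
  have := hG.circleAverage_re_herglotzRieszKernel_smul' hz
  rw [← integral_comp_pt] at this
  simpa [poisson, pk] using this

section
variable {E : Type*} [NormedAddCommGroup E] [NormedSpace ℝ E]

lemma integrable_pk_smul {z : ℂ} (hz : z ∈ ball (0 : ℂ) 1) {u : Torus → E}
    (hu : Integrable u m) : Integrable (fun t => pk z t • u t) m := by
  refine hu.bdd_smul (φ := pk z) ((1 + ‖z‖) / (1 - ‖z‖))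
    (continuous_pk hz).aestronglyMeasurable (Eventually.of_forall fun t => ?_)
  rw [Real.norm_eq_abs, abs_of_pos (pk_pos hz t)]
  exact pk_le hz t

lemma integral_pk {z : ℂ} (hz : z ∈ ball (0 : ℂ) 1) : ∫ t, pk z t ∂m = 1 := by
  have h := poisson_of_diffContOnCl (G := fun _ => 1) diffContOnCl_const hz
  have : ((∫ t, pk z t ∂m : ℝ) : ℂ) = 1 := by
    rw [← h, poisson, ← integral_complex_ofReal]; simp
  exact_mod_cast this

lemma poisson_const [CompleteSpace E] {z : ℂ} (hz : z ∈ ball (0 : ℂ) 1) (c : E) :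
    poisson (fun _ => c) z = c := by
  rw [poisson, integral_smul_const, integral_pk hz, one_smul]

lemma poisson_add {z : ℂ} (hz : z ∈ ball (0 : ℂ) 1) {u v : Torus → E} (hu : Integrable u m)
    (hv : Integrable v m) : poisson (fun t => u t + v t) z = poisson u z + poisson v z := by
  simp only [poisson, smul_add]
  exact integral_add (integrable_pk_smul hz hu) (integrable_pk_smul hz hv)

lemma poisson_sub {z : ℂ} (hz : z ∈ ball (0 : ℂ) 1) {u v : Torus → E} (hu : Integrable u m)
    (hv : Integrable v m) : poisson (fun t => u t - v t) z = poisson u z - poisson v z := by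
  simp only [poisson, smul_sub]
  exact integral_sub (integrable_pk_smul hz hu) (integrable_pk_smul hz hv)

lemma norm_poisson_le {z : ℂ} (hz : z ∈ ball (0 : ℂ) 1) (u : Torus → E) :
    ‖poisson u z‖ ≤ poisson (fun t => ‖u t‖) z := by
  refine (norm_integral_le_integral_norm _).trans_eq (integral_congr_ae (.of_forall fun t => ?_))
  simp [norm_smul, abs_of_pos (pk_pos hz t)]

end

lemma poisson_mono {z : ℂ} (hz : z ∈ ball (0 : ℂ) 1) {u v : Torus → ℝ} (hu : Integrable u m)
    (hv : Integrable v m) (h : u ≤ᵐ[m] v) : poisson u z ≤ poisson v z := by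
  refine integral_mono_ae (integrable_pk_smul hz hu) (integrable_pk_smul hz hv) ?_
  filter_upwards [h] with t ht
  exact mul_le_mul_of_nonneg_left ht (pk_pos hz t).le

lemma re_poisson {z : ℂ} (hz : z ∈ ball (0 : ℂ) 1) {u : Torus → ℂ} (hu : Integrable u m) :
    (poisson u z).re = poisson (fun t => (u t).re) z := by
  have := integral_re (𝕜 := ℂ) (integrable_pk_smul hz hu)
  simp only [poisson]
  simp only [RCLike.re_to_complex] at this
  rw [← this]
  simp

lemma poisson_nonneg {z : ℂ} (hz : z ∈ ball (0 : ℂ) 1) {u : Torus → ℝ} (h : 0 ≤ᵐ[m] u) :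
    0 ≤ poisson u z := by
  refine integral_nonneg_of_ae ?_
  filter_upwards [h] with t ht
  exact mul_nonneg (pk_pos hz t).le ht

/-- `P (r e^{is}, e^{it})` is symmetric in `s` and `t`. -/
lemma pk_symm (r : ℝ) (s t : Torus) : pk (r * pt s) t = pk (r * pt t) s := by
  have h : ‖pt t - r * pt s‖ = ‖pt s - r * pt t‖ := by
    have h1 : pt t - r * pt s = pt t * pt s * conj (pt s - r * pt t) := by
      have ht := pt_ne_zero t
      have hs := pt_ne_zero s
      simp only [map_sub, map_mul, conj_pt, Complex.conj_ofReal]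
      field_simp
    rw [h1]
    simp only [norm_mul, norm_pt, RCLike.norm_conj, one_mul]
  rw [pk_eq, pk_eq, h]
  simp

/-! ### The Herglotz integral -/

/-- The Herglotz integral of `u`: the holomorphic function with real part the Poisson integral. -/
noncomputable def herglotz (u : Torus → ℂ) (z : ℂ) : ℂ :=
  ∫ t, (pt t + z) / (pt t - z) * u t ∂m

lemma integrable_herglotz {z : ℂ} (hz : z ∈ ball (0 : ℂ) 1) {u : Torus → ℂ}
    (hu : Integrable u m) : Integrable (fun t => (pt t + z) / (pt t - z) * u t) m := by
  obtain ⟨C, hC⟩ := isCompact_univ.exists_bound_of_continuousOn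
    (continuous_herglotzKernel hz).continuousOn
  exact hu.bdd_mul (c := C) (continuous_herglotzKernel hz).aestronglyMeasurable
    (Eventually.of_forall fun t => hC t trivial)

lemma differentiableOn_herglotz {u : Torus → ℂ} (hu : Integrable u m) :
    DifferentiableOn ℂ (herglotz u) (ball 0 1) := by
  -- the circle-average lemmas need a function on `ℂ`: extend `u` to be constant on rays
  set v : ℂ → ℂ := fun z => u (Complex.arg z : Torus) with hv
  have hvpt : ∀ t : Torus, v (pt t) = u t := by
    intro t
    induction t using QuotientAddGroup.induction_on with
    | H x =>
      simp only [hv]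
      congr 1
      change ((Complex.arg (pt (x : Torus)) : ℝ) : Torus) = (x : Torus)
      rw [pt_coe, Complex.arg_exp_mul_I]
      rw [toIocMod]
      rw [AddCircle.coe_sub, sub_eq_self]
      exact (AddCircle.coe_eq_zero_iff _).2 ⟨_, rfl⟩
  have hci : CircleIntegrable v 0 1 := by
    have h2 : ∀ θ : ℝ, v (circleMap 0 1 θ) = u (θ : Torus) := by
      intro θ
      rw [← hvpt, pt_coe]; simp [circleMap]
    have h3 : Integrable u volume := by
      rw [AddCircle.volume_eq_smul_haarAddCircle]
      exact hu.smul_measure ENNReal.ofReal_ne_top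
    have h4 := AddCircle.measurePreserving_mk (2 * π) 0
    have h5 := h4.integrable_comp_of_integrable h3
    rw [CircleIntegrable, intervalIntegrable_iff, Set.uIoc_of_le Real.two_pi_pos.le]
    simp only [h2]
    simpa [IntegrableOn, Function.comp_def] using h5
  refine (differentiableOn_circleAverage_herglotzRieszKernel_smul hci).congr fun z hz => ?_
  rw [← integral_comp_pt]
  simp [herglotz, herglotzRieszKernel_def, hvpt]

lemma re_herglotz {z : ℂ} (hz : z ∈ ball (0 : ℂ) 1) {u : Torus → ℝ} (hu : Integrable u m) :
    (herglotz (fun t => (u t : ℂ)) z).re = poisson u z := by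
  have := integral_re (𝕜 := ℂ) (integrable_herglotz hz hu.ofReal)
  rw [RCLike.re_to_complex] at this
  rw [herglotz, poisson]
  refine this.symm.trans (integral_congr_ae (.of_forall fun t => ?_))
  simp [pk]

lemma im_herglotz {z : ℂ} (hz : z ∈ ball (0 : ℂ) 1) {u : Torus → ℝ} (hu : Integrable u m) :
    (herglotz (fun t => (u t : ℂ)) z).im = conjPoisson u z := by
  have := integral_im (𝕜 := ℂ) (integrable_herglotz hz hu.ofReal)
  rw [RCLike.im_to_complex] at this
  rw [herglotz, conjPoisson]
  refine this.symm.trans (integral_congr_ae (.of_forall fun t => ?_))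
  simp


/-! ### Fatou's theorem -/

/-- The layer-cake estimate behind Fatou's theorem: a measure whose mass on small balls about `t₀`
is at most `η` times the radius has bounded integral against `δ / (δ² + d(t, t₀)²)`. -/
lemma lintegral_kernel_le (ν : Measure Torus) [IsFiniteMeasure ν] (t₀ : Torus) {η s₀ δ : ℝ}
    (hη : 0 ≤ η) (hs₀ : 0 < s₀) (hδ : 0 < δ)
    (hν : ∀ s, 0 < s → s ≤ s₀ → ν (closedBall t₀ s) ≤ ENNReal.ofReal (η * s)) :
    ∫⁻ t, ENNReal.ofReal (δ / (δ ^ 2 + dist t t₀ ^ 2)) ∂ν ≤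
      ENNReal.ofReal (2 * η) + ENNReal.ofReal (δ / s₀ ^ 2) * ν Set.univ := by
  have hcont : Continuous fun t : Torus => δ / (δ ^ 2 + dist t t₀ ^ 2) :=
    continuous_const.div (by fun_prop) fun t => by positivity
  rw [← lintegral_add_compl _ (isClosed_closedBall (x := t₀) (ε := s₀)).measurableSet]
  gcongr
  · set ν' := ν.restrict (closedBall t₀ s₀) with hν'
    have hν1 : ∀ s, 0 < s → ν' (closedBall t₀ s) ≤ ENNReal.ofReal (η * s) := by
      intro s hs
      rcases le_total s s₀ with h | h
      · exact (Measure.restrict_apply_le _ _).trans (hν s hs h)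
      · calc ν' (closedBall t₀ s) ≤ ν' Set.univ := measure_mono (Set.subset_univ _)
          _ = ν (closedBall t₀ s₀) := by simp [hν']
          _ ≤ ENNReal.ofReal (η * s₀) := hν s₀ hs₀ le_rfl
          _ ≤ ENNReal.ofReal (η * s) := by gcongr
    rw [lintegral_eq_lintegral_meas_le ν' (Eventually.of_forall fun t => by positivity)
      hcont.aemeasurable]
    have hpt : ∀ s ∈ Set.Ioi (0 : ℝ), ν' {a | s ≤ δ / (δ ^ 2 + dist a t₀ ^ 2)} ≤
        (Set.Ioc 0 (1 / δ)).indicator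
          (fun s => ENNReal.ofReal (η * (√δ * s ^ (-(1 / 2) : ℝ)))) s := by
      intro s hs
      have hs : 0 < s := hs
      by_cases h : s ≤ 1 / δ
      · rw [Set.indicator_of_mem (Set.mem_Ioc.2 ⟨hs, h⟩)]
        have h2 : √δ * s ^ (-(1 / 2) : ℝ) = √(δ / s) := by
          rw [Real.sqrt_div hδ.le, Real.rpow_neg hs.le, ← Real.sqrt_eq_rpow]; rfl
        rw [h2]
        refine (measure_mono fun a ha => ?_).trans (hν1 _ (Real.sqrt_pos.2 (by positivity)))
        rw [Set.mem_ofPred_eq, le_div_iff₀ (by positivity)] at ha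
        refine Real.le_sqrt_of_sq_le ?_
        rw [le_div_iff₀ hs]
        nlinarith [sq_nonneg δ]
      · rw [Set.indicator_of_notMem (fun h' => h h'.2)]
        refine le_of_eq ?_
        convert measure_empty (μ := ν')
        ext a
        simp only [Set.mem_ofPred_eq, Set.mem_empty_iff_false, iff_false, not_le]
        push Not at h
        refine lt_of_le_of_lt ?_ h
        rw [div_le_div_iff₀ (by positivity) hδ]
        nlinarith [sq_nonneg (dist a t₀)]
    refine (setLIntegral_mono' measurableSet_Ioi hpt).trans ?_
    rw [setLIntegral_indicator measurableSet_Ioc,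
      Set.inter_eq_left.2 (Set.Ioc_subset_Ioi_self)]
    have hii : IntervalIntegrable (fun s : ℝ => η * (√δ * s ^ (-(1 / 2) : ℝ))) volume 0 (1 / δ) :=
      ((intervalIntegral.intervalIntegrable_rpow' (by norm_num)).const_mul _).const_mul _
    rw [← ofReal_integral_eq_lintegral_ofReal
      ((intervalIntegrable_iff_integrableOn_Ioc_of_le (by positivity)).1 hii)
      ((ae_restrict_iff' measurableSet_Ioc).2 (.of_forall fun s hs => by
        have := hs.1; positivity))]
    rw [← intervalIntegral.integral_of_le (by positivity)]
    refine ENNReal.ofReal_le_ofReal (le_of_eq ?_)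
    rw [intervalIntegral.integral_const_mul, intervalIntegral.integral_const_mul,
      integral_rpow (Or.inl (by norm_num))]
    have : (-(1 / 2) + 1 : ℝ) = 1 / 2 := by norm_num
    rw [this, Real.zero_rpow (by norm_num), ← Real.sqrt_eq_rpow, Real.sqrt_div zero_le_one,
      Real.sqrt_one]
    have := Real.sqrt_pos.2 hδ
    field_simp
    ring
  · calc _ ≤ ∫⁻ t in (closedBall t₀ s₀)ᶜ, ENNReal.ofReal (δ / s₀ ^ 2) ∂ν := by
          refine setLIntegral_mono' measurableSet_closedBall.compl fun t ht => ?_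
          simp only [Set.mem_compl_iff, mem_closedBall, not_le] at ht
          gcongr
          nlinarith [sq_nonneg δ]
      _ ≤ _ := by
          rw [setLIntegral_const]
          gcongr
          exact Set.subset_univ _

/-- Almost every point is a Lebesgue point. -/
lemma ae_lebesgue_point {u : Torus → ℂ} (hu : Integrable u m) :
    ∀ᵐ t₀ ∂m, ∀ η : ℝ, 0 < η → ∃ s₀ > 0, ∀ s, 0 < s → s ≤ s₀ →
      ∫⁻ t in closedBall t₀ s, ‖u t - u t₀‖ₑ ∂m ≤ ENNReal.ofReal (η * s) := by
  have huv : Integrable u volume := by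
    rw [AddCircle.volume_eq_smul_haarAddCircle]
    exact hu.smul_measure ENNReal.ofReal_ne_top
  have hac : m ≪ (volume : Measure Torus) := by
    rw [AddCircle.volume_eq_smul_haarAddCircle]
    exact Measure.AbsolutelyContinuous.rfl.smul_right (by simp [Real.pi_pos])
  have hle : m ≤ (volume : Measure Torus) := by
    rw [AddCircle.volume_eq_smul_haarAddCircle]
    intro s
    rw [Measure.smul_apply, smul_eq_mul]
    refine le_mul_of_one_le_left zero_le ?_
    rw [← ENNReal.ofReal_one]
    exact ENNReal.ofReal_le_ofReal (by nlinarith [Real.two_le_pi])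
  filter_upwards [hac (IsUnifLocDoublingMeasure.ae_tendsto_average_norm_sub
    (volume : Measure Torus) huv.locallyIntegrable 1)] with t₀ h η hη
  have h1 := h (l := 𝓝[>] (0 : ℝ)) (fun _ => t₀) id tendsto_id
    (by filter_upwards [self_mem_nhdsWithin] with s hs
        exact mem_closedBall_self (by simpa using (le_of_lt hs)))
  have h2 := (h1.eventually (gt_mem_nhds (half_pos hη)))
  obtain ⟨s₀, hs₀, h3⟩ := mem_nhdsGT_iff_exists_Ioc_subset.1 h2
  refine ⟨s₀, hs₀, fun s hs hss => ?_⟩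
  have h4 : ⨍ y in closedBall t₀ s, ‖u y - u t₀‖ < η / 2 := h3 ⟨hs, hss⟩
  have hint : Integrable (fun y => u y - u t₀) volume := huv.sub (integrable_const _)
  have h5 : ∫ y in closedBall t₀ s, ‖u y - u t₀‖ ≤ η * s := by
    have h6 := measure_smul_setAverage (μ := volume) (fun y => ‖u y - u t₀‖)
      (s := closedBall t₀ s) (measure_ne_top _ _)
    rw [← h6, smul_eq_mul]
    have h7 : volume.real (closedBall t₀ s) ≤ 2 * s := by
      rw [Measure.real, AddCircle.volume_closedBall]
      refine ENNReal.toReal_le_of_le_ofReal (by linarith) (ENNReal.ofReal_le_ofReal ?_)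
      exact min_le_right _ _
    calc _ ≤ (2 * s) * (η / 2) :=
          mul_le_mul h7 h4.le (integral_nonneg fun _ => norm_nonneg _) (by positivity)
      _ = η * s := by ring
  calc ∫⁻ t in closedBall t₀ s, ‖u t - u t₀‖ₑ ∂m
      ≤ ∫⁻ t in closedBall t₀ s, ‖u t - u t₀‖ₑ :=
        lintegral_mono' (Measure.restrict_mono le_rfl hle) le_rfl
    _ = ENNReal.ofReal (∫ y in closedBall t₀ s, ‖u y - u t₀‖) :=
        (ofReal_integral_norm_eq_lintegral_enorm hint.restrict).symm
    _ ≤ _ := ENNReal.ofReal_le_ofReal h5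

/-- In a Stolz angle at `e^{it₀}` the Poisson kernel is dominated by a multiple of
`δ / (δ² + d(t, t₀)²)`, `δ = 1 - |z|`. -/
lemma pk_le_of_mem_stolz {α : ℝ} {t₀ : Torus} {z : ℂ} (hz : z ∈ stolz α (pt t₀)) (t : Torus) :
    pk z t ≤ 2 * (1 + (π / 2 * (1 + α)) ^ 2) * ((1 - ‖z‖) / ((1 - ‖z‖) ^ 2 + dist t t₀ ^ 2)) := by
  obtain ⟨hz1, hz2⟩ := hz
  set δ := 1 - ‖z‖ with hδ
  have hδ0 : 0 < δ := by linarith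
  have hα : 0 < α := pos_of_mul_pos_left ((norm_nonneg _).trans_lt hz2) hδ0.le
  set x := ‖pt t - z‖ with hx
  have h1 : δ ≤ x := by
    have := norm_sub_norm_le (pt t) z
    rw [norm_pt] at this; exact this
  have h2 : ‖pt t - pt t₀‖ ≤ (1 + α) * x := by
    have : ‖pt t - pt t₀‖ ≤ ‖pt t - z‖ + ‖z - pt t₀‖ := norm_sub_le_norm_sub_add_norm_sub _ _ _
    nlinarith
  have h3 : dist t t₀ ≤ π / 2 * (1 + α) * x := by
    have h4 := (dist_le_norm_pt_sub t t₀).trans h2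
    calc dist t t₀ = π / 2 * (2 / π * dist t t₀) := by field_simp
      _ ≤ π / 2 * ((1 + α) * x) := by gcongr
      _ = _ := by ring
  have h5 : δ ^ 2 + dist t t₀ ^ 2 ≤ (1 + (π / 2 * (1 + α)) ^ 2) * x ^ 2 := by
    have := pow_le_pow_left₀ dist_nonneg h3 2
    have := pow_le_pow_left₀ hδ0.le h1 2
    nlinarith
  have hx0 : 0 < x := hδ0.trans_le h1
  rw [pk_eq, mul_div_assoc', div_le_div_iff₀ (by positivity) (by positivity)]
  have h6 : 1 - ‖z‖ ^ 2 ≤ 2 * δ := by nlinarith [norm_nonneg z]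
  calc (1 - ‖z‖ ^ 2) * (δ ^ 2 + dist t t₀ ^ 2)
      ≤ (2 * δ) * ((1 + (π / 2 * (1 + α)) ^ 2) * x ^ 2) := by gcongr
    _ = _ := by ring

/-- **Fatou's theorem**: the Poisson integral of an integrable function converges
nontangentially to it almost everywhere. -/
theorem ae_tendsto_poisson {u : Torus → ℂ} (hu : Integrable u m) :
    ∀ᵐ t ∂m, Tendsto (poisson u) (nontangential (pt t)) (𝓝 (u t)) := by
  filter_upwards [ae_lebesgue_point hu] with t₀ h
  refine tendsto_nontangential_iff.2 fun α => ?_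
  obtain ⟨C, hC⟩ : ∃ C : ℝ, C = 2 * (1 + (π / 2 * (1 + α)) ^ 2) := ⟨_, rfl⟩
  have hC0 : 0 < C := by rw [hC]; positivity
  have hint : Integrable (fun t => u t - u t₀) m := hu.sub (integrable_const _)
  set ν := m.withDensity fun t => ‖u t - u t₀‖ₑ with hν
  have hνfin : IsFiniteMeasure ν := isFiniteMeasure_withDensity hint.2.ne
  have hmeas : AEMeasurable (fun t => ‖u t - u t₀‖ₑ) m := hint.1.enorm
  have hbound : ∀ z ∈ stolz α (pt t₀), ‖poisson u z - u t₀‖ₑ ≤ ENNReal.ofReal C *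
      ∫⁻ t, ENNReal.ofReal ((1 - ‖z‖) / ((1 - ‖z‖) ^ 2 + dist t t₀ ^ 2)) ∂ν := by
    intro z hz
    have hzb : z ∈ ball (0 : ℂ) 1 := by simpa using hz.1
    have hδ0 : 0 < 1 - ‖z‖ := by linarith [hz.1]
    have e1 : poisson u z - u t₀ = poisson (fun t => u t - u t₀) z := by
      rw [poisson_sub hzb hu (integrable_const _), poisson_const hzb]
    have hk : Measurable fun t : Torus =>
        ENNReal.ofReal ((1 - ‖z‖) / ((1 - ‖z‖) ^ 2 + dist t t₀ ^ 2)) := by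
      refine ENNReal.measurable_ofReal.comp (Continuous.measurable ?_)
      exact continuous_const.div (by fun_prop) fun t => by positivity
    rw [e1, poisson, hν, lintegral_withDensity_eq_lintegral_mul₀ hmeas hk.aemeasurable,
      ← lintegral_const_mul' _ _ ENNReal.ofReal_ne_top]
    refine (enorm_integral_le_lintegral_enorm _).trans (lintegral_mono fun t => ?_)
    rw [enorm_smul, Pi.mul_apply, mul_left_comm, ← ENNReal.ofReal_mul hC0.le,
      mul_comm ‖u t - u t₀‖ₑ]
    gcongr
    rw [Real.enorm_eq_ofReal (pk_pos hzb t).le, hC]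
    exact ENNReal.ofReal_le_ofReal (pk_le_of_mem_stolz hz t)
  rw [tendsto_iff_edist_tendsto_0, ENNReal.tendsto_nhds_zero]
  intro ε hε
  obtain ⟨ε', hε'0, hε'⟩ : ∃ ε' : ℝ, 0 < ε' ∧ ENNReal.ofReal ε' ≤ ε := by
    rcases eq_or_ne ε ∞ with rfl | hε1
    · exact ⟨1, one_pos, le_top⟩
    · exact ⟨ε.toReal, ENNReal.toReal_pos hε.ne' hε1, ENNReal.ofReal_toReal_le⟩
  obtain ⟨s₀, hs₀, hs⟩ := h (ε' / (4 * C)) (by positivity)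
  have hlim : Tendsto (fun z : ℂ => C * ((1 - ‖z‖) / s₀ ^ 2 * (ν Set.univ).toReal))
      (𝓝[stolz α (pt t₀)] (pt t₀)) (𝓝 0) := by
    have : Tendsto (fun z : ℂ => C * ((1 - ‖z‖) / s₀ ^ 2 * (ν Set.univ).toReal))
      (𝓝 (pt t₀)) (𝓝 (C * ((1 - ‖pt t₀‖) / s₀ ^ 2 * (ν Set.univ).toReal))) :=
      Continuous.tendsto (by fun_prop) _
    simpa using this.mono_left nhdsWithin_le_nhds
  filter_upwards [self_mem_nhdsWithin, hlim.eventually (gt_mem_nhds (half_pos hε'0))] with z hz hz2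
  have hδ0 : 0 < 1 - ‖z‖ := by linarith [hz.1]
  have h5 := lintegral_kernel_le ν t₀ (η := ε' / (4 * C)) (by positivity) hs₀ hδ0
    (fun s hs1 hs2 => by
      rw [hν, withDensity_apply _ measurableSet_closedBall]
      exact hs s hs1 hs2)
  rw [edist_eq_enorm_sub]
  refine (hbound z hz).trans (le_trans ?_ hε')
  calc _ ≤ ENNReal.ofReal C * (ENNReal.ofReal (2 * (ε' / (4 * C))) +
        ENNReal.ofReal ((1 - ‖z‖) / s₀ ^ 2) * ν Set.univ) := by gcongr
    _ = ENNReal.ofReal (C * (2 * (ε' / (4 * C)) +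
        (1 - ‖z‖) / s₀ ^ 2 * (ν Set.univ).toReal)) := by
      rw [ENNReal.ofReal_mul hC0.le, ENNReal.ofReal_add (by positivity) (by positivity),
        ENNReal.ofReal_mul (p := (1 - ‖z‖) / s₀ ^ 2) (by positivity), ENNReal.ofReal_toReal (measure_ne_top _ _)]
    _ ≤ ENNReal.ofReal ε' := by
      refine ENNReal.ofReal_le_ofReal ?_
      have : C * (2 * (ε' / (4 * C))) = ε' / 2 := by field_simp; ring
      rw [mul_add, this]
      linarith

/-- Fatou's theorem for a real-valued function. -/
lemma ae_tendsto_poisson_real {u : Torus → ℝ} (hu : Integrable u m) :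
    ∀ᵐ t ∂m, Tendsto (poisson u) (nontangential (pt t)) (𝓝 (u t)) := by
  filter_upwards [ae_tendsto_poisson hu.ofReal] with t ht
  have h1 := (Complex.continuous_re.tendsto _).comp ht
  refine Tendsto.congr' ?_ h1
  filter_upwards [ball_mem_nontangential (pt t)] with z hz
  simpa using re_poisson hz (u := fun t => (u t : ℂ)) hu.ofReal


/-! ### Boundary values of bounded holomorphic functions -/

/-- A bounded holomorphic function on the disk is the Poisson integral of an integrable function,
obtained as a weak limit in `L²` of its dilations. -/
lemma exists_eq_poisson_of_bounded {F : ℂ → ℂ} (hF : DifferentiableOn ℂ F (ball 0 1)) {M : ℝ}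
    (hM : ∀ z ∈ ball (0 : ℂ) 1, ‖F z‖ ≤ M) :
    ∃ f : Torus → ℂ, Integrable f m ∧ ∀ z ∈ ball (0 : ℂ) 1, poisson f z = F z := by
  have hmem : ∀ n, MemLp (fun t : Torus => F (radius n * pt t)) 2 m := fun n =>
    MemLp.of_bound (continuous_dilate hF (radius_mem n)).aestronglyMeasurable M
      (.of_forall fun t => hM _ (mul_pt_mem_ball (radius_mem n) t))
  set Fn : ℕ → Lp ℂ 2 m := fun n => (hmem n).toLp _ with hFn
  have hFnM : ∀ n, ‖Fn n‖ ≤ M := by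
    intro n
    have hM0 : 0 ≤ M := (norm_nonneg _).trans (hM 0 (by simp))
    have := Lp.norm_le_of_ae_bound (f := Fn n) hM0 (by
      filter_upwards [(hmem n).coeFn_toLp] with t ht
      rw [hFn]; simp only [ht]
      exact hM _ (mul_pt_mem_ball (radius_mem n) t))
    simpa [measureUnivNNReal] using this
  set Λ : ℕ → WeakDual ℂ (Lp ℂ 2 m) := fun n =>
    StrongDual.toWeakDual (InnerProductSpace.toDual ℂ _ (Fn n)) with hΛ
  have hcomp := WeakDual.isCompact_closedBall (0 : StrongDual ℂ (Lp ℂ 2 m)) M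
  obtain ⟨L, -, hL⟩ := hcomp.ultrafilter_le_nhds ((hyperfilter ℕ).map Λ) (by
    refine le_principal_iff.2 (mem_map.2 (Eventually.of_forall fun n => ?_))
    simp only [Set.mem_preimage, mem_closedBall, dist_zero_right, hΛ]
    change ‖InnerProductSpace.toDual ℂ _ (Fn n)‖ ≤ M
    rw [LinearIsometryEquiv.norm_map]
    exact hFnM n)
  set f : Lp ℂ 2 m := (InnerProductSpace.toDual ℂ _).symm (WeakDual.toStrongDual L) with hf
  refine ⟨f, (Lp.memLp f).integrable (by norm_num), fun z hz => ?_⟩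
  have hk : MemLp (fun t => (pk z t : ℂ)) 2 m := by
    have hc : Continuous fun t => (pk z t : ℂ) := Complex.continuous_ofReal.comp (continuous_pk hz)
    exact MemLp.of_bound hc.aestronglyMeasurable ((1 + ‖z‖) / (1 - ‖z‖)) (.of_forall fun t => by
      rw [Complex.norm_real, Real.norm_eq_abs, abs_of_pos (pk_pos hz t)]
      exact pk_le hz t)
  have hinner : ∀ g : Lp ℂ 2 m, inner ℂ g (hk.toLp _) = conj (poisson g z) := by
    intro g
    rw [L2.inner_def, poisson, ← integral_conj]
    refine integral_congr_ae ?_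
    filter_upwards [hk.coeFn_toLp] with t ht
    simp only [ht, RCLike.inner_apply, Complex.real_smul, map_mul, Complex.conj_ofReal]
  have h1 : Tendsto (fun n => Λ n (hk.toLp _)) (hyperfilter ℕ) (𝓝 (L (hk.toLp _))) :=
    ((WeakDual.eval_continuous (hk.toLp _)).tendsto L).comp hL
  have h2 : L (hk.toLp _) = conj (poisson f z) := by
    rw [← hinner, hf]
    rw [InnerProductSpace.toDual_symm_apply]
    rfl
  have h3 : ∀ n, Λ n (hk.toLp _) = conj (F (radius n * z)) := by
    intro n
    change InnerProductSpace.toDual ℂ _ (Fn n) (hk.toLp _) = _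
    rw [InnerProductSpace.toDual_apply_apply, hinner]
    congr 1
    rw [← poisson_of_diffContOnCl (diffContOnCl_dilate hF (radius_mem n)) hz]
    refine integral_congr_ae ?_
    filter_upwards [(hmem n).coeFn_toLp] with t ht
    rw [hFn]; simp only [ht]
  have h4 : Tendsto (fun n => F (radius n * z)) (hyperfilter ℕ) (𝓝 (F z)) := by
    have := (hF.continuousOn.continuousAt (isOpen_ball.mem_nhds hz)).tendsto.comp
      (tendsto_radius_mul z)
    exact this.mono_left Nat.hyperfilter_le_atTop
  have h5 := (Complex.continuous_conj.tendsto _).comp h4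
  simp only [h3, h2] at h1
  have := tendsto_nhds_unique h1 h5
  exact (starRingEnd ℂ).injective this

/-- Bounded holomorphic functions have nontangential limits almost everywhere. -/
lemma exists_boundary_of_bounded {F : ℂ → ℂ} (hF : DifferentiableOn ℂ F (ball 0 1)) {M : ℝ}
    (hM : ∀ z ∈ ball (0 : ℂ) 1, ‖F z‖ ≤ M) :
    ∃ f : Torus → ℂ, ∀ᵐ t ∂m, Tendsto F (nontangential (pt t)) (𝓝 (f t)) := by
  obtain ⟨f, hf, hfF⟩ := exists_eq_poisson_of_bounded hF hM
  refine ⟨f, (ae_tendsto_poisson hf).mono fun t ht => ht.congr' ?_⟩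
  filter_upwards [ball_mem_nontangential (pt t)] with z hz using hfF z hz

/-- A bounded holomorphic function belongs to every Hardy space of the disk. -/
lemma memHardyDisk_of_bounded {F : ℂ → ℂ} (hF : DifferentiableOn ℂ F (ball 0 1)) {M : ℝ}
    (hM : ∀ z ∈ ball (0 : ℂ) 1, ‖F z‖ ≤ M) (q : ℝ≥0∞) : MemHardyDisk q F := by
  refine ⟨hF, lt_of_le_of_lt (iSup₂_le fun r hr => ?_) (ENNReal.ofReal_lt_top (r := M))⟩
  have := eLpNorm_le_of_ae_bound (p := q) (μ := m) (f := fun t : Torus => F (r * pt t)) (C := M)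
    (.of_forall fun t => hM _ (mul_pt_mem_ball hr t))
  simpa using this

/-! ### Subharmonicity of `log |F|` -/

/-- Every continuous real function on the circle is uniformly close to the real part of an entire
function: density of trigonometric polynomials. -/
lemma exists_entire_re_close {h : Torus → ℝ} (hh : Continuous h) {η : ℝ} (hη : 0 < η) :
    ∃ q : ℂ → ℂ, Differentiable ℂ q ∧ ∀ t, |(q (pt t)).re - h t| < η := by
  have hspan : ∀ T ∈ Submodule.span ℂ (Set.range (@fourier (2 * π))),
      ∃ q₁ q₂ : ℂ → ℂ, Differentiable ℂ q₁ ∧ Differentiable ℂ q₂ ∧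
        ∀ t, T t = q₁ (pt t) + conj (q₂ (pt t)) := by
    intro T hT
    induction hT using Submodule.span_induction with
    | mem T hT =>
      obtain ⟨n, rfl⟩ := hT
      rcases Int.eq_nat_or_neg n with ⟨k, rfl | rfl⟩
      · exact ⟨fun z => z ^ k, 0, by fun_prop, by fun_prop, fun t => by
          rw [fourier_eq_pt_zpow]; simp⟩
      · exact ⟨0, fun z => z ^ k, by fun_prop, by fun_prop, fun t => by
          rw [fourier_eq_pt_zpow]; simp [conj_pt]⟩
    | zero => exact ⟨0, 0, by fun_prop, by fun_prop, by simp⟩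
    | add T₁ T₂ _ _ h₁ h₂ =>
      obtain ⟨a, b, ha, hb, hab⟩ := h₁
      obtain ⟨c, d, hc, hd, hcd⟩ := h₂
      exact ⟨a + c, b + d, ha.add hc, hb.add hd, fun t => by
        simp [hab, hcd]; ring⟩
    | smul c T _ h =>
      obtain ⟨a, b, ha, hb, hab⟩ := h
      exact ⟨fun z => c * a z, fun z => conj c * b z, by fun_prop, by fun_prop, fun t => by
        simp [hab]; ring⟩
  set H : C(Torus, ℂ) := ⟨fun t => (h t : ℂ), Complex.continuous_ofReal.comp hh⟩ with hH
  have hmem : H ∈ (Submodule.span ℂ (Set.range (@fourier (2 * π)))).topologicalClosure := by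
    rw [span_fourier_closure_eq_top]; trivial
  obtain ⟨T, hT, hdist⟩ := Metric.mem_closure_iff.1 hmem η hη
  obtain ⟨q₁, q₂, h₁, h₂, hq⟩ := hspan T hT
  refine ⟨fun z => q₁ z + q₂ z, h₁.add h₂, fun t => ?_⟩
  have e1 : (q₁ (pt t) + q₂ (pt t)).re = (T t).re := by rw [hq]; simp
  have e2 : (T t).re - h t = (T t - H t).re := by simp [hH]
  rw [e1, e2]
  refine (Complex.abs_re_le_norm _).trans_lt ?_
  rw [← dist_eq_norm, dist_comm]
  exact (ContinuousMap.dist_apply_le_dist t).trans_lt hdist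

/-- Subharmonicity of `log |G|` up to the boundary: a continuous majorant `h` of `log |G|` on the
circle yields the majorant `P[h]` inside. With `h` close to `Re q`, this is the maximum principle
for `G exp (-q)`. -/
lemma norm_le_exp_poisson {G : ℂ → ℂ} (hG : DiffContOnCl ℂ G (ball 0 1)) {h : Torus → ℝ}
    (hh : Continuous h) (hGh : ∀ t, ‖G (pt t)‖ ≤ Real.exp (h t)) {z : ℂ}
    (hz : z ∈ ball (0 : ℂ) 1) : ‖G z‖ ≤ Real.exp (poisson h z) := by
  have hhi : Integrable h m :=
    hh.integrable_of_hasCompactSupport (HasCompactSupport.of_compactSpace h)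
  have key : ∀ η : ℝ, 0 < η → ‖G z‖ ≤ Real.exp (poisson h z + 2 * η) := by
    intro η hη
    obtain ⟨q, hq, hqh⟩ := exists_entire_re_close hh hη
    have hqi : Integrable (fun t => q (pt t)) m :=
      (hq.continuous.comp continuous_pt).integrable_of_hasCompactSupport
        (HasCompactSupport.of_compactSpace _)
    have hD : DiffContOnCl ℂ (fun w => Complex.exp (-q w) • G w) (ball 0 1) :=
      (by fun_prop : Differentiable ℂ fun w => Complex.exp (-q w)).diffContOnCl.smul hG
    have h1 : ‖Complex.exp (-q z) • G z‖ ≤ Real.exp η := by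
      refine Complex.norm_le_of_forall_mem_frontier_norm_le isBounded_ball hD (fun w hw => ?_)
        (subset_closure hz)
      rw [frontier_ball 0 one_ne_zero] at hw
      obtain ⟨t, rfl⟩ : ∃ t : Torus, pt t = w := by
        refine ⟨(Complex.arg w : ℝ), ?_⟩
        rw [pt_coe]
        have := Complex.norm_mul_exp_arg_mul_I w
        rwa [mem_sphere_zero_iff_norm.1 hw, Complex.ofReal_one, one_mul] at this
      rw [norm_smul, Complex.norm_exp, Complex.neg_re]
      calc _ ≤ Real.exp (-(q (pt t)).re) * Real.exp (h t) := by gcongr; exact hGh t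
        _ = Real.exp (-(q (pt t)).re + h t) := (Real.exp_add _ _).symm
        _ ≤ _ := Real.exp_le_exp.2 (by have := abs_lt.1 (hqh t); linarith)
    have h2 : (q z).re ≤ poisson h z + η := by
      rw [← poisson_of_diffContOnCl hq.diffContOnCl hz, re_poisson hz hqi]
      have := poisson_mono hz (u := fun t => (q (pt t)).re) (v := fun t => h t + η) hqi.re
        (hhi.add (integrable_const η)) (.of_forall fun t => by
          have := abs_lt.1 (hqh t); simp only; linarith)
      rwa [poisson_add hz hhi (integrable_const η), poisson_const hz] at this
    rw [norm_smul, Complex.norm_exp, Complex.neg_re] at h1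
    calc ‖G z‖ = Real.exp (q z).re * (Real.exp (-(q z).re) * ‖G z‖) := by
          rw [← mul_assoc, ← Real.exp_add]; simp
      _ ≤ Real.exp (poisson h z + η) * Real.exp η := by gcongr
      _ = _ := by rw [← Real.exp_add]; ring_nf
  have hlim : Tendsto (fun η : ℝ => Real.exp (poisson h z + 2 * η)) (𝓝[>] 0)
      (𝓝 (Real.exp (poisson h z))) := by
    have : Tendsto (fun η : ℝ => Real.exp (poisson h z + 2 * η)) (𝓝 0)
      (𝓝 (Real.exp (poisson h z + 2 * 0))) := Continuous.tendsto (by fun_prop) _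
    simpa using this.mono_left nhdsWithin_le_nhds
  exact ge_of_tendsto hlim (by filter_upwards [self_mem_nhdsWithin] with η hη using key η hη)


lemma MemHardyDisk.mono {p q : ℝ≥0∞} {F : ℂ → ℂ} (hF : MemHardyDisk q F) (hpq : p ≤ q) :
    MemHardyDisk p F := by
  refine ⟨hF.1, lt_of_le_of_lt (iSup₂_mono fun r hr => ?_) hF.2⟩
  exact eLpNorm_le_eLpNorm_of_exponent_le hpq (continuous_dilate hF.1 hr).aestronglyMeasurable

lemma MemHardyDisk.exists_bound {q : ℝ≥0∞} {F : ℂ → ℂ} (hF : MemHardyDisk q F) :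
    ∃ B : ℝ, 0 ≤ B ∧ ∀ r ∈ Set.Ioo (0 : ℝ) 1,
      eLpNorm (fun t : Torus => F (r * pt t)) q m ≤ ENNReal.ofReal B :=
  ⟨_, ENNReal.toReal_nonneg, fun r hr => by
    rw [ENNReal.ofReal_toReal hF.2.ne]
    exact le_iSup₂ (f := fun (r : ℝ) (_ : r ∈ Set.Ioo (0 : ℝ) 1) =>
      eLpNorm (fun t : Torus => F (r * pt t)) q m) r hr⟩

/-- The boundary function of an `H^q` function lies in `L^q`. -/
lemma MemHardyDisk.memLp_boundary {q : ℝ≥0∞} {F : ℂ → ℂ} (hF : MemHardyDisk q F) {f : Torus → ℂ}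
    (hf : ∀ᵐ t ∂m, Tendsto F (nontangential (pt t)) (𝓝 (f t))) : MemLp f q m := by
  obtain ⟨B, -, hB⟩ := hF.exists_bound
  refine ⟨aestronglyMeasurable_boundary hF.1 hf, lt_of_le_of_lt ?_ (ENNReal.ofReal_lt_top (r := B))⟩
  refine (Lp.eLpNorm_lim_le_liminf_eLpNorm
    (fun n => (continuous_dilate hF.1 (radius_mem n)).aestronglyMeasurable) f
    (hf.mono fun _ ht => tendsto_dilate ht)).trans ?_
  exact liminf_le_of_le (by isBoundedDefault) fun b hb =>
    (hb.exists).elim fun n hn => hn.trans (hB _ (radius_mem n))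

/-- Truncation of the logarithm: the excess over `log (min x M + ε)` is controlled by `x ^ p`. -/
lemma log_add_le {p x M ε : ℝ} (hp : 0 < p) (hx : 0 ≤ x) (hM : 0 < M) (hε : 0 < ε) :
    Real.log (x + ε) ≤ Real.log (min x M + ε) + x ^ p / (p * M ^ p) := by
  rcases le_total x M with h | h
  · rw [min_eq_left h]
    have : 0 ≤ x ^ p / (p * M ^ p) := by positivity
    linarith
  · rw [min_eq_right h]
    have h1 : Real.log (x + ε) - Real.log (M + ε) ≤ Real.log (x / M) := by
      rw [← Real.log_div (by positivity) (by positivity)]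
      apply Real.log_le_log (by positivity)
      rw [div_le_div_iff₀ (by positivity) hM]
      nlinarith
    have h2 := Real.log_le_rpow_div (show 0 ≤ x / M by positivity) hp
    rw [Real.div_rpow hx hM.le, div_div, mul_comm (M ^ p)] at h2
    linarith

lemma abs_log_add_le {x M ε : ℝ} (hx : 0 ≤ x) (hxM : x ≤ M) (hε : 0 < ε) :
    |Real.log (x + ε)| ≤ |Real.log ε| + |Real.log (M + ε)| := by
  have h1 : Real.log ε ≤ Real.log (x + ε) := Real.log_le_log hε (by linarith)
  have h2 : Real.log (x + ε) ≤ Real.log (M + ε) := Real.log_le_log (by linarith) (by linarith)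
  rw [abs_le]
  constructor
  · linarith [neg_abs_le (Real.log ε), abs_nonneg (Real.log (M + ε))]
  · linarith [le_abs_self (Real.log (M + ε)), abs_nonneg (Real.log ε)]

lemma integrable_log_add {f : Torus → ℂ} {p : ℝ} (hp : 0 < p) (hf : AEStronglyMeasurable f m)
    (hfp : Integrable (fun t => ‖f t‖ ^ p) m) {ε : ℝ} (hε : 0 < ε) :
    Integrable (fun t => Real.log (‖f t‖ + ε)) m := by
  refine Integrable.mono' (g := fun t => |Real.log ε| + |Real.log (1 + ε)| + ‖f t‖ ^ p / p)
    ((integrable_const _).add (hfp.div_const p))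
    (Real.measurable_log.comp_aemeasurable (hf.norm.aemeasurable.add_const ε)).aestronglyMeasurable
    (.of_forall fun t => ?_)
  have h0 := norm_nonneg (f t)
  have h1 := log_add_le hp h0 one_pos hε
  rw [Real.one_rpow, mul_one] at h1
  have h2 := abs_log_add_le (le_min h0 zero_le_one) (min_le_right ‖f t‖ 1) hε
  have h3 : Real.log ε ≤ Real.log (‖f t‖ + ε) := Real.log_le_log hε (by linarith)
  have h4 : 0 ≤ ‖f t‖ ^ p / p := by positivity
  rw [Real.norm_eq_abs, abs_le]
  constructor
  · linarith [neg_abs_le (Real.log ε), abs_nonneg (Real.log (1 + ε))]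
  · linarith [le_abs_self (Real.log (min ‖f t‖ 1 + ε))]

lemma integral_rpow_le_of_eLpNorm_le {p : ℝ} (hp : 0 < p) {u : Torus → ℂ} (hu : Continuous u)
    {B : ℝ} (hB : 0 ≤ B) (h : eLpNorm u (ENNReal.ofReal p) m ≤ ENNReal.ofReal B) :
    ∫ t, ‖u t‖ ^ p ∂m ≤ B ^ p := by
  have hmem : MemLp u (ENNReal.ofReal p) m :=
    ⟨hu.aestronglyMeasurable, h.trans_lt ENNReal.ofReal_lt_top⟩
  rw [hmem.eLpNorm_eq_integral_rpow_norm (by simpa using hp) ENNReal.ofReal_ne_top,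
    ENNReal.toReal_ofReal hp.le] at h
  have h1 := (ENNReal.ofReal_le_ofReal_iff hB).1 h
  have h0 : 0 ≤ ∫ t, ‖u t‖ ^ p ∂m := integral_nonneg fun t => by positivity
  calc _ = ((∫ t, ‖u t‖ ^ p ∂m) ^ p⁻¹) ^ p := by
        rw [← Real.rpow_mul h0, inv_mul_cancel₀ hp.ne', Real.rpow_one]
    _ ≤ _ := Real.rpow_le_rpow (by positivity) h1 hp.le

/-- The majorization of `log |F|` by the Poisson integral of `log (|f| + ε)`. Dilations of `F` are
compared with `F` itself through a truncation of `|F|` at height `M`, the `L^p` bound making the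
truncation error uniformly small. -/
lemma norm_le_exp_poisson_log_add {p : ℝ} (hp : 0 < p) {F : ℂ → ℂ}
    (hF : MemHardyDisk (ENNReal.ofReal p) F) {f : Torus → ℂ}
    (hf : ∀ᵐ t ∂m, Tendsto F (nontangential (pt t)) (𝓝 (f t))) {ε : ℝ} (hε : 0 < ε) {z : ℂ}
    (hz : z ∈ ball (0 : ℂ) 1) :
    ‖F z‖ ≤ Real.exp (poisson (fun t => Real.log (‖f t‖ + ε)) z) := by
  obtain ⟨B, hB0, hB⟩ := hF.exists_bound
  set C : ℝ := (1 + ‖z‖) / (1 - ‖z‖) with hC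
  have hz1 : ‖z‖ < 1 := by simpa using hz
  have hC0 : 0 < C := div_pos (by positivity) (by linarith)
  have hfm := aestronglyMeasurable_boundary hF.1 hf
  have hfp : Integrable (fun t => ‖f t‖ ^ p) m := by
    have := (hF.memLp_boundary hf).integrable_norm_rpow (by simpa using hp) ENNReal.ofReal_ne_top
    rwa [ENNReal.toReal_ofReal hp.le] at this
  have htrunc : ∀ M : ℝ, ∀ u : Torus → ℂ, 0 < M → AEStronglyMeasurable u m →
      Integrable (fun t => Real.log (min ‖u t‖ M + ε)) m := fun M u hM hu =>
    (integrable_const (|Real.log ε| + |Real.log (M + ε)|)).mono'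
      (Real.measurable_log.comp_aemeasurable
        ((hu.norm.aemeasurable.min aemeasurable_const).add_const ε)).aestronglyMeasurable
      (.of_forall fun t => abs_log_add_le (le_min (norm_nonneg _) hM.le) (min_le_right _ _) hε)
  have step : ∀ M : ℝ, 0 < M → ‖F z‖ ≤
      Real.exp (poisson (fun t => Real.log (‖f t‖ + ε)) z + C * B ^ p / (p * M ^ p)) := by
    intro M hM
    set k : ℕ → Torus → ℂ := fun n t => F (radius n * pt t) with hk
    have hkc : ∀ n, Continuous (k n) := fun n => continuous_dilate hF.1 (radius_mem n)
    have h1 : ∀ n, ‖F (radius n * z)‖ ≤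
        Real.exp (poisson (fun t => Real.log (min ‖k n t‖ M + ε)) z + C * B ^ p / (p * M ^ p)) := by
      intro n
      have hpos : ∀ t, 0 < ‖k n t‖ + ε := fun t => by positivity
      have hlc : Continuous fun t => Real.log (‖k n t‖ + ε) :=
        ((hkc n).norm.add continuous_const).log fun t => (hpos t).ne'
      have hkp : Integrable (fun t => ‖k n t‖ ^ p) m :=
        ((hkc n).norm.rpow_const fun t => Or.inr hp.le).integrable_of_hasCompactSupport
          (HasCompactSupport.of_compactSpace _)
      refine (norm_le_exp_poisson (diffContOnCl_dilate hF.1 (radius_mem n)) hlc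
        (fun t => ?_) hz).trans (Real.exp_le_exp.2 ?_)
      · rw [Real.exp_log (hpos t)]
        change ‖k n t‖ ≤ _
        linarith
      · have h2 := poisson_mono hz (u := fun t => Real.log (‖k n t‖ + ε))
          (v := fun t => Real.log (min ‖k n t‖ M + ε) + ‖k n t‖ ^ p / (p * M ^ p))
          (hlc.integrable_of_hasCompactSupport (HasCompactSupport.of_compactSpace _))
          ((htrunc M _ hM (hkc n).aestronglyMeasurable).add (hkp.div_const _))
          (.of_forall fun t => log_add_le hp (norm_nonneg _) hM hε)
        rw [poisson_add hz (htrunc M _ hM (hkc n).aestronglyMeasurable) (hkp.div_const _)] at h2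
        refine h2.trans (add_le_add_right ?_ _)
        calc poisson (fun t => ‖k n t‖ ^ p / (p * M ^ p)) z
            ≤ ∫ t, C / (p * M ^ p) * ‖k n t‖ ^ p ∂m := by
              refine integral_mono (integrable_pk_smul hz (hkp.div_const _)) (hkp.const_mul _)
                fun t => ?_
              simp only [smul_eq_mul]
              calc _ ≤ C * (‖k n t‖ ^ p / (p * M ^ p)) := by gcongr; exact pk_le hz t
                _ = _ := by ring
          _ = C / (p * M ^ p) * ∫ t, ‖k n t‖ ^ p ∂m := integral_const_mul _ _
          _ ≤ C / (p * M ^ p) * B ^ p := by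
              gcongr
              exact integral_rpow_le_of_eLpNorm_le hp (hkc n) hB0 (hB _ (radius_mem n))
          _ = _ := by ring
    have h2 : Tendsto (fun n => poisson (fun t => Real.log (min ‖k n t‖ M + ε)) z) atTop
        (𝓝 (poisson (fun t => Real.log (min ‖f t‖ M + ε)) z)) := by
      refine tendsto_integral_of_dominated_convergence
        (fun _ => C * (|Real.log ε| + |Real.log (M + ε)|))
        (fun n => (integrable_pk_smul hz
          (htrunc M _ hM (hkc n).aestronglyMeasurable)).aestronglyMeasurable)
        (integrable_const _) (fun n => .of_forall fun t => ?_) ?_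
      · rw [norm_smul, Real.norm_eq_abs, abs_of_pos (pk_pos hz t)]
        gcongr
        · exact pk_le hz t
        · exact abs_log_add_le (le_min (norm_nonneg _) hM.le) (min_le_right _ _) hε
      · filter_upwards [hf] with t ht
        have h3 := (tendsto_dilate ht).norm.min (tendsto_const_nhds (x := M))
        exact ((h3.add_const ε).log (by positivity)).const_smul _
    have h4 : Tendsto (fun n => ‖F (radius n * z)‖) atTop (𝓝 ‖F z‖) :=
      ((hF.1.continuousOn.continuousAt (isOpen_ball.mem_nhds hz)).tendsto.comp
        (tendsto_radius_mul z)).norm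
    refine (le_of_tendsto_of_tendsto' h4
      ((Real.continuous_exp.tendsto _).comp (h2.add_const _)) h1).trans (Real.exp_le_exp.2 ?_)
    gcongr
    refine poisson_mono hz (htrunc M f hM hfm) (integrable_log_add hp hfm hfp hε)
      (.of_forall fun t => Real.log_le_log (by positivity) ?_)
    gcongr
    exact min_le_left _ _
  have hlim : Tendsto (fun M : ℝ => Real.exp (poisson (fun t => Real.log (‖f t‖ + ε)) z +
      C * B ^ p / (p * M ^ p))) atTop
      (𝓝 (Real.exp (poisson (fun t => Real.log (‖f t‖ + ε)) z + 0))) := by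
    refine (Real.continuous_exp.tendsto _).comp (tendsto_const_nhds.add ?_)
    exact tendsto_const_nhds.div_atTop ((tendsto_rpow_atTop hp).const_mul_atTop hp)
  rw [add_zero] at hlim
  exact ge_of_tendsto hlim ((eventually_gt_atTop 0).mono step)

/-- **Log-integrability and the Jensen inequality for Hardy functions**: if `F ∈ H^q` does not
vanish identically, then its boundary function `f` has `log |f| ∈ L¹`, and `log |F|` is at most the
Poisson integral of `log |f|`. -/
theorem MemHardyDisk.norm_le_exp_poisson_log {q : ℝ≥0∞} (hq : q ≠ 0) {F : ℂ → ℂ}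
    (hF : MemHardyDisk q F) {f : Torus → ℂ}
    (hf : ∀ᵐ t ∂m, Tendsto F (nontangential (pt t)) (𝓝 (f t))) {z₀ : ℂ}
    (hz₀ : z₀ ∈ ball (0 : ℂ) 1) (hFz₀ : F z₀ ≠ 0) :
    LogIntegrable (fun t => ‖f t‖) ∧
      ∀ z ∈ ball (0 : ℂ) 1, ‖F z‖ ≤ Real.exp (poisson (fun t => Real.log ‖f t‖) z) := by
  obtain ⟨p, hp, hFp⟩ : ∃ p : ℝ, 0 < p ∧ MemHardyDisk (ENNReal.ofReal p) F := by
    have h1 : min q 1 ≠ ∞ := ((min_le_right q 1).trans_lt ENNReal.one_lt_top).ne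
    refine ⟨(min q 1).toReal, ENNReal.toReal_pos ?_ h1, hF.mono ?_⟩
    · exact (lt_min (pos_iff_ne_zero.2 hq) one_pos).ne'
    · rw [ENNReal.ofReal_toReal h1]; exact min_le_left _ _
  have hfm := aestronglyMeasurable_boundary hF.1 hf
  have hfp : Integrable (fun t => ‖f t‖ ^ p) m := by
    have := (hFp.memLp_boundary hf).integrable_norm_rpow (by simpa using hp) ENNReal.ofReal_ne_top
    rwa [ENNReal.toReal_ofReal hp.le] at this
  set ε : ℕ → ℝ := fun n => 1 / (n + 1) with hε
  have hε0 : ∀ n, 0 < ε n := fun n => by positivity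
  have hεle : ∀ n, ε n ≤ ε 0 := fun n => by
    simp only [hε]
    exact one_div_le_one_div_of_le (by simp) (by simp)
  have hεlim : Tendsto ε atTop (𝓝 0) := tendsto_one_div_add_atTop_nhds_zero_nat
  -- `u n` decreases to `log |f|`; the value of `log |F|` at `z₀` bounds `∫ (u 0 - u n)`, and Fatou's
  -- lemma then excludes zeros of `f`, where `Real.log` would take the junk value `0`
  set u : ℕ → Torus → ℝ := fun n t => Real.log (‖f t‖ + ε n) with hu
  have hui : ∀ n, Integrable (u n) m := fun n => integrable_log_add hp hfm hfp (hε0 n)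
  have hule : ∀ n t, u n t ≤ u 0 t := fun n t =>
    Real.log_le_log (add_pos_of_nonneg_of_pos (norm_nonneg _) (hε0 n)) (by linarith [hεle n])
  have hF_le : ∀ n, ∀ z ∈ ball (0 : ℂ) 1, ‖F z‖ ≤ Real.exp (poisson (u n) z) := fun n z hz =>
    norm_le_exp_poisson_log_add hp hFp hf (hε0 n) hz
  set c : ℝ := (1 - ‖z₀‖) / (1 + ‖z₀‖) with hc
  have hz₀1 : ‖z₀‖ < 1 := by simpa using hz₀
  have hc0 : 0 < c := div_pos (by linarith) (by positivity)
  set D : ℝ := (poisson (u 0) z₀ - Real.log ‖F z₀‖) / c with hD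
  have hvint : ∀ n, ∫ t, (u 0 t - u n t) ∂m ≤ D := by
    intro n
    rw [hD, le_div_iff₀ hc0, mul_comm, ← integral_const_mul]
    have h1 : Real.log ‖F z₀‖ ≤ poisson (u n) z₀ := by
      rw [Real.log_le_iff_le_exp (norm_pos_iff.2 hFz₀)]
      exact hF_le n z₀ hz₀
    have h2 : ∫ t, c * (u 0 t - u n t) ∂m ≤ poisson (fun t => u 0 t - u n t) z₀ := by
      refine integral_mono (((hui 0).sub (hui n)).const_mul c)
        (integrable_pk_smul hz₀ ((hui 0).sub (hui n))) fun t => ?_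
      exact mul_le_mul_of_nonneg_right (le_pk hz₀ t) (sub_nonneg.2 (hule n t))
    rw [poisson_sub hz₀ (hui 0) (hui n)] at h2
    linarith
  have hfatou : ∫⁻ t, liminf (fun n => ENNReal.ofReal (u 0 t - u n t)) atTop ∂m ≤
      ENNReal.ofReal D := by
    refine (lintegral_liminf_le' fun n =>
      ((hui 0).sub (hui n)).1.aemeasurable.ennreal_ofReal).trans ?_
    refine liminf_le_of_le (by isBoundedDefault) fun b hb => hb.exists.elim fun n hn => hn.trans ?_
    rw [← ofReal_integral_eq_lintegral_ofReal ((hui 0).sub (hui n))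
      (.of_forall fun t => sub_nonneg.2 (hule n t))]
    exact ENNReal.ofReal_le_ofReal (hvint n)
  have hfin : ∀ᵐ t ∂m, liminf (fun n => ENNReal.ofReal (u 0 t - u n t)) atTop < ∞ := by
    refine ae_lt_top' ?_ (hfatou.trans_lt ENNReal.ofReal_lt_top).ne
    simp only [liminf_eq_iSup_iInf_of_nat']
    exact AEMeasurable.iSup fun n => AEMeasurable.iInf fun i =>
      ((hui 0).sub (hui (i + n))).1.aemeasurable.ennreal_ofReal
  have hpos : ∀ᵐ t ∂m, 0 < ‖f t‖ := by
    filter_upwards [hfin] with t ht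
    by_contra h
    have hft : ‖f t‖ = 0 := le_antisymm (not_lt.1 h) (norm_nonneg _)
    refine ht.ne (Tendsto.liminf_eq ?_)
    refine ENNReal.tendsto_ofReal_atTop.comp ?_
    have h1 : (fun n => u 0 t - u n t) = fun n : ℕ => Real.log ((n : ℝ) + 1) := by
      ext n
      simp [hu, hε, hft]
    change Tendsto (fun n => u 0 t - u n t) atTop atTop
    rw [h1]
    exact Real.tendsto_log_atTop.comp
      (tendsto_atTop_add_const_right _ _ tendsto_natCast_atTop_atTop)
  have hulim : ∀ᵐ t ∂m, Tendsto (fun n => u n t) atTop (𝓝 (Real.log ‖f t‖)) := by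
    filter_upwards [hpos] with t ht
    have := (hεlim.const_add ‖f t‖)
    rw [add_zero] at this
    exact this.log ht.ne'
  have hlogle : ∀ᵐ t ∂m, ∀ n, Real.log ‖f t‖ ≤ u n t := by
    filter_upwards [hpos] with t ht n
    exact Real.log_le_log ht (by linarith [hε0 n])
  have hlogm : AEStronglyMeasurable (fun t => Real.log ‖f t‖) m :=
    (Real.measurable_log.comp_aemeasurable hfm.norm.aemeasurable).aestronglyMeasurable
  have hw : Integrable (fun t => u 0 t - Real.log ‖f t‖) m := by
    refine (lintegral_ofReal_ne_top_iff_integrable ((hui 0).1.sub hlogm)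
      (hlogle.mono fun t ht => sub_nonneg.2 (ht 0))).1 ?_
    refine (lt_of_le_of_lt ?_ (hfatou.trans_lt ENNReal.ofReal_lt_top)).ne
    refine le_of_eq (lintegral_congr_ae ?_)
    filter_upwards [hulim] with t ht
    exact ((ENNReal.continuous_ofReal.tendsto _).comp (ht.const_sub (u 0 t))).liminf_eq.symm
  have hlog : Integrable (fun t => Real.log ‖f t‖) m := by
    have := (hui 0).sub hw
    refine this.congr (.of_forall fun t => ?_)
    simp
  refine ⟨⟨hpos, hlog⟩, fun z hz => ?_⟩
  have hlim : Tendsto (fun n => poisson (u n) z) atTop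
      (𝓝 (poisson (fun t => Real.log ‖f t‖) z)) := by
    refine tendsto_integral_of_dominated_convergence
      (fun t => pk z t * (|u 0 t| + |Real.log ‖f t‖|))
      (fun n => (integrable_pk_smul hz (hui n)).aestronglyMeasurable)
      (integrable_pk_smul hz ((hui 0).abs.add hlog.abs)) (fun n => ?_) ?_
    · filter_upwards [hlogle] with t ht
      rw [norm_smul, Real.norm_eq_abs, abs_of_pos (pk_pos hz t)]
      refine mul_le_mul_of_nonneg_left ?_ (pk_pos hz t).le
      rw [Real.norm_eq_abs, abs_le]
      constructor
      · linarith [ht n, neg_abs_le (Real.log ‖f t‖), abs_nonneg (u 0 t)]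
      · linarith [hule n t, le_abs_self (u 0 t), abs_nonneg (Real.log ‖f t‖)]
    · filter_upwards [hulim] with t ht using ht.const_smul _
  exact ge_of_tendsto' ((Real.continuous_exp.tendsto _).comp hlim) fun n => hF_le n z hz


/-! ### The conjugate Poisson integral and outer functions -/

lemma herglotz_congr {u v : Torus → ℂ} (h : u =ᵐ[m] v) : herglotz u = herglotz v := by
  ext z
  exact integral_congr_ae (h.mono fun t ht => by simp only [ht])

lemma herglotz_add {u v : Torus → ℂ} (hu : Integrable u m) (hv : Integrable v m) {z : ℂ}
    (hz : z ∈ ball (0 : ℂ) 1) :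
    herglotz (fun t => u t + v t) z = herglotz u z + herglotz v z := by
  simp only [herglotz, mul_add]
  exact integral_add (integrable_herglotz hz hu) (integrable_herglotz hz hv)

/-- The Herglotz integral of a nonnegative function has nontangential limits: `1 / (1 + H)` is
bounded, and its boundary function cannot vanish on a set of positive measure. -/
lemma exists_boundary_herglotz {u : Torus → ℝ} (hu : Integrable u m) (hu0 : 0 ≤ᵐ[m] u) :
    ∃ h : Torus → ℂ, ∀ᵐ t ∂m,
      Tendsto (herglotz fun s => (u s : ℂ)) (nontangential (pt t)) (𝓝 (h t)) := by
  set H := herglotz fun s => (u s : ℂ) with hH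
  have hre : ∀ z ∈ ball (0 : ℂ) 1, 1 ≤ (1 + H z).re := fun z hz => by
    simp [hH, re_herglotz hz hu, poisson_nonneg hz hu0]
  have hne : ∀ z ∈ ball (0 : ℂ) 1, 1 + H z ≠ 0 := fun z hz h0 => by
    have := hre z hz
    rw [h0, Complex.zero_re] at this
    linarith
  have hd : DifferentiableOn ℂ (fun z => (1 + H z)⁻¹) (ball 0 1) :=
    ((differentiableOn_const 1).add (differentiableOn_herglotz hu.ofReal)).inv hne
  have hb : ∀ z ∈ ball (0 : ℂ) 1, ‖(1 + H z)⁻¹‖ ≤ 1 := fun z hz => by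
    rw [norm_inv]
    exact inv_le_one_of_one_le₀ ((hre z hz).trans (Complex.re_le_norm _))
  obtain ⟨g, hg⟩ := exists_boundary_of_bounded hd hb
  have h0 : (0 : ℂ) ∈ ball (0 : ℂ) 1 := by simp
  obtain ⟨⟨hg0, -⟩, -⟩ := (memHardyDisk_of_bounded hd hb 1).norm_le_exp_poisson_log one_ne_zero hg
    h0 (inv_ne_zero (hne 0 h0))
  refine ⟨fun t => (g t)⁻¹ - 1, ?_⟩
  filter_upwards [hg, hg0] with t ht ht0
  have := (ht.inv₀ (norm_pos_iff.1 ht0)).sub_const 1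
  simpa using this

/-- The conjugate Poisson integral of an integrable function has nontangential limits almost
everywhere, so that `harmConj` is not a junk value. -/
theorem ae_tendsto_conjPoisson {u : Torus → ℝ} (hu : Integrable u m) :
    ∀ᵐ t ∂m, Tendsto (conjPoisson u) (nontangential (pt t)) (𝓝 (harmConj u t)) := by
  obtain ⟨h₁, H₁⟩ := exists_boundary_herglotz hu.pos_part (.of_forall fun t => le_max_right _ _)
  obtain ⟨h₂, H₂⟩ := exists_boundary_herglotz hu.neg_part (.of_forall fun t => le_max_right _ _)
  filter_upwards [H₁, H₂] with t ht₁ ht₂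
  refine tendsto_nhds_limUnder ⟨(h₁ t - h₂ t).im, ?_⟩
  refine ((Complex.continuous_im.tendsto _).comp (ht₁.sub ht₂)).congr' ?_
  filter_upwards [ball_mem_nontangential (pt t)] with z hz
  have h : herglotz (fun s => ((max (u s) 0 : ℝ) : ℂ)) z =
      herglotz (fun s => (u s : ℂ)) z + herglotz (fun s => ((max (-u s) 0 : ℝ) : ℂ)) z := by
    rw [← herglotz_add (u := fun s => (u s : ℂ)) (v := fun s => ((max (-u s) 0 : ℝ) : ℂ))
      hu.ofReal hu.neg_part.ofReal hz]
    congr 1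
    ext s
    rw [← Complex.ofReal_add]
    congr 1
    rcases le_total (u s) 0 with hs | hs
    · rw [max_eq_right hs, max_eq_left (neg_nonneg.2 hs), add_neg_cancel]
    · rw [max_eq_left hs, max_eq_right (neg_nonpos.2 hs), add_zero]
  rw [← im_herglotz hz hu, Function.comp_apply, h, add_sub_cancel_right]

/-- The outer function with boundary modulus `w`, as a function on the disk. -/
noncomputable def outerDisk (w : Torus → ℝ) (z : ℂ) : ℂ :=
  Complex.exp (herglotz (fun t => (Real.log (w t) : ℂ)) z)

lemma differentiableOn_outerDisk {w : Torus → ℝ} (hw : LogIntegrable w) :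
    DifferentiableOn ℂ (outerDisk w) (ball 0 1) :=
  (differentiableOn_herglotz hw.2.ofReal).cexp

lemma norm_outerDisk {w : Torus → ℝ} (hw : LogIntegrable w) {z : ℂ} (hz : z ∈ ball (0 : ℂ) 1) :
    ‖outerDisk w z‖ = Real.exp (poisson (fun t => Real.log (w t)) z) := by
  rw [outerDisk, Complex.norm_exp, re_herglotz hz hw.2]

lemma norm_outerFn {w : Torus → ℝ} {t : Torus} (ht : 0 < w t) : ‖outerFn w t‖ = w t := by
  rw [outerFn, Complex.norm_exp]
  simp [Real.exp_log ht]

lemma outerFn_ne_zero (w : Torus → ℝ) (t : Torus) : outerFn w t ≠ 0 := Complex.exp_ne_zero _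

lemma ae_tendsto_outerDisk {w : Torus → ℝ} (hw : LogIntegrable w) :
    ∀ᵐ t ∂m, Tendsto (outerDisk w) (nontangential (pt t)) (𝓝 (outerFn w t)) := by
  filter_upwards [ae_tendsto_conjPoisson hw.2, ae_tendsto_poisson_real hw.2] with t h₁ h₂
  refine (Complex.continuous_exp.tendsto _).comp ?_
  have h₃ := ((Complex.continuous_ofReal.tendsto _).comp h₂).add
    (((Complex.continuous_ofReal.tendsto _).comp h₁).const_mul Complex.I)
  refine h₃.congr' ?_
  filter_upwards [ball_mem_nontangential (pt t)] with z hz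
  simp only [Function.comp]
  rw [← re_herglotz hz hw.2, ← im_herglotz hz hw.2, mul_comm Complex.I]
  exact Complex.re_add_im _

lemma LogIntegrable.congr {w v : Torus → ℝ} (hw : LogIntegrable w) (h : w =ᵐ[m] v) :
    LogIntegrable v := by
  refine ⟨?_, hw.2.congr (h.mono fun t ht => by simp only [ht])⟩
  filter_upwards [hw.1, h] with t h1 h2
  rwa [← h2]

lemma LogIntegrable.mul {w v : Torus → ℝ} (hw : LogIntegrable w) (hv : LogIntegrable v) :
    LogIntegrable fun t => w t * v t := by
  refine ⟨?_, (hw.2.add hv.2).congr ?_⟩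
  · filter_upwards [hw.1, hv.1] with t h1 h2 using mul_pos h1 h2
  · filter_upwards [hw.1, hv.1] with t h1 h2
    simp [Real.log_mul h1.ne' h2.ne']

lemma LogIntegrable.inv {w : Torus → ℝ} (hw : LogIntegrable w) :
    LogIntegrable fun t => (w t)⁻¹ := by
  refine ⟨hw.1.mono fun t ht => inv_pos.2 ht, ?_⟩
  simp only [Real.log_inv]
  exact hw.2.neg

lemma LogIntegrable.sqrt {w : Torus → ℝ} (hw : LogIntegrable w) :
    LogIntegrable fun t => √(w t) := by
  refine ⟨hw.1.mono fun t ht => Real.sqrt_pos.2 ht, (hw.2.div_const 2).congr ?_⟩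
  filter_upwards [hw.1] with t ht
  rw [Real.log_sqrt ht.le]

lemma outerFn_mul {w v : Torus → ℝ} (hw : LogIntegrable w) (hv : LogIntegrable v) :
    outerFn (fun t => w t * v t) =ᵐ[m] fun t => outerFn w t * outerFn v t := by
  filter_upwards [ae_tendsto_outerDisk hw, ae_tendsto_outerDisk hv,
    ae_tendsto_outerDisk (hw.mul hv)] with t h1 h2 h3
  refine tendsto_nhds_unique h3 ((h1.mul h2).congr' ?_)
  filter_upwards [ball_mem_nontangential (pt t)] with z hz
  rw [outerDisk, outerDisk, outerDisk, ← Complex.exp_add]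
  congr 1
  rw [← herglotz_add (u := fun s => (Real.log (w s) : ℂ)) (v := fun s => (Real.log (v s) : ℂ))
    hw.2.ofReal hv.2.ofReal hz]
  refine congrFun (herglotz_congr ?_) z
  filter_upwards [hw.1, hv.1] with s h1 h2
  rw [Real.log_mul h1.ne' h2.ne', Complex.ofReal_add]

lemma outerFn_congr {w v : Torus → ℝ} (h : w =ᵐ[m] v) : outerFn w =ᵐ[m] outerFn v := by
  have hc : conjPoisson (fun s => Real.log (w s)) = conjPoisson fun s => Real.log (v s) := by
    ext z
    exact integral_congr_ae (h.mono fun t ht => by simp only [ht])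
  filter_upwards [h] with t ht
  simp only [outerFn, ht, harmConj, hc]

/-! ### Growth of outer functions -/

/-- Jensen's inequality for the exponential and the Poisson measure. -/
lemma exp_poisson_le {v : Torus → ℝ} (hv : Integrable v m)
    (hev : Integrable (fun t => Real.exp (v t)) m) {z : ℂ} (hz : z ∈ ball (0 : ℂ) 1) :
    Real.exp (poisson v z) ≤ poisson (fun t => Real.exp (v t)) z := by
  set a := poisson v z with ha
  -- compare `exp` with its tangent line at `a`
  have h1 : Integrable (fun t => Real.exp a * v t + Real.exp a * (1 - a)) m :=
    (hv.const_mul _).add (integrable_const _)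
  have h2 := poisson_mono hz h1 hev (.of_forall fun t => by
    have h3 := Real.add_one_le_exp (v t - a)
    calc Real.exp a * v t + Real.exp a * (1 - a) = Real.exp a * (v t - a + 1) := by ring
      _ ≤ Real.exp a * Real.exp (v t - a) := by gcongr
      _ = Real.exp (v t) := by rw [← Real.exp_add]; ring_nf)
  have h4 : poisson (fun t => Real.exp a * v t) z = Real.exp a * a := by
    simp only [poisson, ha, smul_eq_mul, mul_left_comm _ (Real.exp _)]
    rw [integral_const_mul]
  rw [poisson_add hz (hv.const_mul _) (integrable_const _), poisson_const hz, h4] at h2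
  linarith

lemma measurable_pk_dilate (r : ℝ) :
    Measurable fun x : Torus × Torus => ENNReal.ofReal (pk (r * pt x.1) x.2) := by
  simp only [pk_eq]
  have h1 : Measurable fun x : Torus × Torus => (r : ℂ) * pt x.1 :=
    (by fun_prop : Continuous fun x : Torus × Torus => (r : ℂ) * pt x.1).measurable
  have h2 : Measurable fun x : Torus × Torus => pt x.2 - (r : ℂ) * pt x.1 :=
    (by fun_prop : Continuous fun x : Torus × Torus => pt x.2 - (r : ℂ) * pt x.1).measurable
  exact (((h1.norm.pow_const 2).const_sub 1).div (h2.norm.pow_const 2)).ennreal_ofReal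

/-- The mean of a Poisson integral over a circle is the mean of its boundary function. -/
lemma lintegral_poisson {u : Torus → ℝ} (hu : Integrable u m) (hu0 : 0 ≤ᵐ[m] u) {r : ℝ}
    (hr : r ∈ Set.Ioo (0 : ℝ) 1) :
    ∫⁻ s, ENNReal.ofReal (poisson u (r * pt s)) ∂m = ∫⁻ t, ENNReal.ofReal (u t) ∂m := by
  have h1 : ∀ s, ENNReal.ofReal (poisson u (r * pt s)) =
      ∫⁻ t, ENNReal.ofReal (pk (r * pt s) t) * ENNReal.ofReal (u t) ∂m := by
    intro s
    have hz := mul_pt_mem_ball hr s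
    rw [poisson, ofReal_integral_eq_lintegral_ofReal (integrable_pk_smul hz hu)]
    · refine lintegral_congr fun t => ?_
      rw [smul_eq_mul, ENNReal.ofReal_mul (pk_pos hz t).le]
    · filter_upwards [hu0] with t ht using mul_nonneg (pk_pos hz t).le ht
  have hmeas := measurable_pk_dilate r
  have h2 : ∀ t, ∫⁻ s, ENNReal.ofReal (pk (r * pt s) t) ∂m = 1 := by
    intro t
    have hz := mul_pt_mem_ball hr t
    have hint : Integrable (pk (r * pt t)) m :=
      (continuous_pk hz).integrable_of_hasCompactSupport (HasCompactSupport.of_compactSpace _)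
    calc ∫⁻ s, ENNReal.ofReal (pk (r * pt s) t) ∂m
        = ∫⁻ s, ENNReal.ofReal (pk (r * pt t) s) ∂m :=
          lintegral_congr fun s => by rw [pk_symm]
      _ = 1 := by
          rw [← ofReal_integral_eq_lintegral_ofReal hint (.of_forall fun s => (pk_pos hz s).le),
            integral_pk hz, ENNReal.ofReal_one]
  have haem : AEMeasurable (fun x : Torus × Torus => ENNReal.ofReal (u x.2)) (m.prod m) :=
    hu.1.aemeasurable.ennreal_ofReal.comp_snd
  calc ∫⁻ s, ENNReal.ofReal (poisson u (r * pt s)) ∂m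
      = ∫⁻ s, ∫⁻ t, ENNReal.ofReal (pk (r * pt s) t) * ENNReal.ofReal (u t) ∂m ∂m :=
        lintegral_congr h1
    _ = ∫⁻ t, ∫⁻ s, ENNReal.ofReal (pk (r * pt s) t) * ENNReal.ofReal (u t) ∂m ∂m :=
        lintegral_lintegral_swap (f := fun s t : Torus =>
          ENNReal.ofReal (pk (r * pt s) t) * ENNReal.ofReal (u t)) (hmeas.aemeasurable.mul haem)
    _ = ∫⁻ t, ENNReal.ofReal (u t) ∂m := by
        refine lintegral_congr fun t => ?_
        rw [lintegral_mul_const' _ _ ENNReal.ofReal_ne_top, h2, one_mul]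

lemma memHardyDisk_outerDisk {w : Torus → ℝ} (hw : LogIntegrable w) {q : ℝ≥0∞} (hq : q ≠ 0)
    (hwq : MemLp w q m) : MemHardyDisk q (outerDisk w) := by
  rcases eq_or_ne q ∞ with rfl | hq'
  · set M : ℝ := (eLpNorm w ∞ m).toReal + 1 with hM
    have hwM : ∀ᵐ t ∂m, w t ≤ M := by
      filter_upwards [ae_le_eLpNormEssSup (f := w) (μ := m)] with t ht
      have h1 : ‖w t‖ ≤ (eLpNorm w ∞ m).toReal := by
        rw [← toReal_enorm]
        exact ENNReal.toReal_mono hwq.2.ne (by simpa using ht)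
      linarith [le_abs_self (w t), Real.norm_eq_abs (w t)]
    refine memHardyDisk_of_bounded (differentiableOn_outerDisk hw) (M := M) (fun z hz => ?_) ∞
    rw [norm_outerDisk hw hz]
    have hM0 : 0 < M := by positivity
    rw [← Real.le_log_iff_exp_le hM0]
    have := poisson_mono hz hw.2 (integrable_const (Real.log M)) (by
      filter_upwards [hwM, hw.1] with t h1 h2 using Real.log_le_log h2 h1)
    rwa [poisson_const hz] at this
  · refine ⟨differentiableOn_outerDisk hw, lt_of_le_of_lt (iSup₂_le fun r hr => ?_) hwq.2⟩
    set p := q.toReal with hp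
    have hp0 : 0 < p := ENNReal.toReal_pos hq hq'
    have hwp := hwq.integrable_norm_rpow hq hq'
    have hexp : (fun t => ‖w t‖ ^ p) =ᵐ[m] fun t => Real.exp (p * Real.log (w t)) := by
      filter_upwards [hw.1] with t ht
      rw [Real.norm_eq_abs, abs_of_pos ht, Real.rpow_def_of_pos ht, mul_comm]
    rw [eLpNorm_eq_lintegral_rpow_enorm_toReal hq hq', eLpNorm_eq_lintegral_rpow_enorm_toReal hq hq']
    gcongr ?_ ^ (1 / p)
    calc ∫⁻ s, ‖outerDisk w (r * pt s)‖ₑ ^ p ∂m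
        ≤ ∫⁻ s, ENNReal.ofReal (poisson (fun t => ‖w t‖ ^ p) (r * pt s)) ∂m := by
          refine lintegral_mono fun s => ?_
          have hz := mul_pt_mem_ball hr s
          rw [← ofReal_norm, ENNReal.ofReal_rpow_of_nonneg (norm_nonneg _) hp0.le,
            norm_outerDisk hw hz, ← Real.exp_mul]
          refine ENNReal.ofReal_le_ofReal ?_
          have h1 := exp_poisson_le (hw.2.const_mul p) (hwp.congr hexp) hz
          have h2 : poisson (fun t => p * Real.log (w t)) (r * pt s) =
              poisson (fun t => Real.log (w t)) (r * pt s) * p := by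
            simp only [poisson, smul_eq_mul, mul_left_comm _ p]
            rw [integral_const_mul, mul_comm]
          rw [h2] at h1
          refine h1.trans_eq (integral_congr_ae ?_)
          filter_upwards [hexp] with t ht
          rw [ht]
      _ = ∫⁻ t, ENNReal.ofReal (‖w t‖ ^ p) ∂m :=
          lintegral_poisson hwp (.of_forall fun t => by positivity) hr
      _ = ∫⁻ t, ‖w t‖ₑ ^ p ∂m := by
          refine lintegral_congr fun t => ?_
          rw [← ofReal_norm, ENNReal.ofReal_rpow_of_nonneg (norm_nonneg _) hp0.le]


/-! ### Inner-outer factorization on the circle -/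

lemma hardy_congr {q : ℝ≥0∞} {f g : Torus → ℂ} (hf : f ∈ Hardy q) (h : f =ᵐ[m] g) :
    g ∈ Hardy q := by
  obtain ⟨F, hF, hFf⟩ := hf
  refine ⟨F, hF, ?_⟩
  filter_upwards [hFf, h] with t h1 h2
  rwa [← h2]

lemma memLp_of_mem_hardy {q : ℝ≥0∞} {f : Torus → ℂ} (hf : f ∈ Hardy q) : MemLp f q m := by
  obtain ⟨F, hF, hFf⟩ := hf
  exact hF.memLp_boundary hFf

lemma zero_mem_hardy (q : ℝ≥0∞) : (fun _ => 0 : Torus → ℂ) ∈ Hardy q :=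
  ⟨fun _ => 0, memHardyDisk_of_bounded (differentiableOn_const 0) (M := 0) (by simp) q,
    .of_forall fun _ => tendsto_const_nhds⟩

lemma exists_ne_zero_of_boundary {F : ℂ → ℂ} {f : Torus → ℂ}
    (hf : ∀ᵐ t ∂m, Tendsto F (nontangential (pt t)) (𝓝 (f t))) (h : ¬ f =ᵐ[m] 0) :
    ∃ z ∈ ball (0 : ℂ) 1, F z ≠ 0 := by
  by_contra! hcon
  refine h (hf.mono fun t ht => ?_)
  refine tendsto_nhds_unique ht (tendsto_const_nhds.congr' ?_)
  filter_upwards [ball_mem_nontangential (pt t)] with z hz using (hcon z hz).symm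

/-- An inner function extends to the disk as a holomorphic function bounded by `1`. -/
lemma IsInner.exists_disk {J : Torus → ℂ} (hJ : IsInner J) :
    ∃ F : ℂ → ℂ, DifferentiableOn ℂ F (ball 0 1) ∧ (∀ z ∈ ball (0 : ℂ) 1, ‖F z‖ ≤ 1) ∧
      ∀ᵐ t ∂m, Tendsto F (nontangential (pt t)) (𝓝 (J t)) := by
  obtain ⟨⟨F, hF, hFJ⟩, hJ1⟩ := hJ
  refine ⟨F, hF.1, fun z hz => ?_, hFJ⟩
  have hJ0 : ¬ J =ᵐ[m] 0 := by
    intro h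
    obtain ⟨t, h1, h2⟩ := (h.and hJ1).exists
    simp [h1] at h2
  obtain ⟨z₀, hz₀, hne⟩ := exists_ne_zero_of_boundary hFJ hJ0
  refine ((hF.norm_le_exp_poisson_log ENNReal.top_ne_zero hFJ hz₀ hne).2 z hz).trans_eq ?_
  have : poisson (fun t => Real.log ‖J t‖) z = 0 := by
    rw [poisson, integral_eq_zero_of_ae]
    filter_upwards [hJ1] with t ht
    simp [ht]
  rw [this, Real.exp_zero]

lemma isInner_of_disk {J : Torus → ℂ} {F : ℂ → ℂ} (hF : DifferentiableOn ℂ F (ball 0 1))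
    (hb : ∀ z ∈ ball (0 : ℂ) 1, ‖F z‖ ≤ 1)
    (hFJ : ∀ᵐ t ∂m, Tendsto F (nontangential (pt t)) (𝓝 (J t))) (hJ : ∀ᵐ t ∂m, ‖J t‖ = 1) :
    IsInner J :=
  ⟨⟨F, memHardyDisk_of_bounded hF hb ∞, hFJ⟩, hJ⟩

lemma isInner_const {c : ℂ} (hc : ‖c‖ = 1) : IsInner fun _ => c :=
  isInner_of_disk (differentiableOn_const c) (fun _ _ => hc.le)
    (.of_forall fun _ => tendsto_const_nhds) (.of_forall fun _ => hc)

lemma IsInner.mul {J J' : Torus → ℂ} (hJ : IsInner J) (hJ' : IsInner J') :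
    IsInner fun t => J t * J' t := by
  obtain ⟨F, hF, hFb, hFJ⟩ := hJ.exists_disk
  obtain ⟨F', hF', hFb', hFJ'⟩ := hJ'.exists_disk
  refine isInner_of_disk (hF.mul hF') (fun z hz => ?_) ?_ ?_
  · simpa using mul_le_one₀ (hFb z hz) (norm_nonneg _) (hFb' z hz)
  · filter_upwards [hFJ, hFJ'] with t h1 h2 using h1.mul h2
  · filter_upwards [hJ.2, hJ'.2] with t h1 h2
    rw [norm_mul, h1, h2, one_mul]

/-- An outer function with modulus in `L^q`, times an inner function, is in `H^q`. -/
lemma outerFn_mul_mem_hardy {w : Torus → ℝ} (hw : LogIntegrable w) {q : ℝ≥0∞} (hq : q ≠ 0)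
    (hwq : MemLp w q m) {J : Torus → ℂ} (hJ : IsInner J) :
    (fun t => outerFn w t * J t) ∈ Hardy q := by
  obtain ⟨F, hF, hFb, hFJ⟩ := hJ.exists_disk
  obtain ⟨hO, hOb⟩ := memHardyDisk_outerDisk hw hq hwq
  refine ⟨fun z => outerDisk w z * F z, ⟨hO.mul hF, lt_of_le_of_lt ?_ hOb⟩, ?_⟩
  · refine iSup₂_mono fun r hr => eLpNorm_mono fun t => ?_
    rw [norm_mul]
    exact mul_le_of_le_one_right (norm_nonneg _) (hFb _ (mul_pt_mem_ball hr t))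
  · filter_upwards [hFJ, ae_tendsto_outerDisk hw] with t h1 h2 using h2.mul h1

/-- **Inner-outer factorization** of a nonzero Hardy function. The quotient of its extension by
the outer function with the same boundary modulus is bounded by `1`. -/
theorem exists_inner_of_mem_hardy {q : ℝ≥0∞} (hq : q ≠ 0) {f : Torus → ℂ} (hf : f ∈ Hardy q)
    (hf0 : ¬ f =ᵐ[m] 0) :
    LogIntegrable (fun t => ‖f t‖) ∧
      ∃ J, IsInner J ∧ f =ᵐ[m] fun t => outerFn (fun s => ‖f s‖) t * J t := by
  obtain ⟨F, hF, hFf⟩ := hf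
  obtain ⟨z₀, hz₀, hne⟩ := exists_ne_zero_of_boundary hFf hf0
  obtain ⟨hlog, hle⟩ := hF.norm_le_exp_poisson_log hq hFf hz₀ hne
  set w : Torus → ℝ := fun s => ‖f s‖ with hw
  refine ⟨hlog, fun t => f t / outerFn w t, ?_, .of_forall fun t => ?_⟩
  · refine isInner_of_disk (F := fun z => F z / outerDisk w z)
      (hF.1.div (differentiableOn_outerDisk hlog) fun z _ => Complex.exp_ne_zero _)
      (fun z hz => ?_) ?_ ?_
    · rw [norm_div, norm_outerDisk hlog hz]
      exact div_le_one_of_le₀ (hle z hz) (Real.exp_pos _).le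
    · filter_upwards [hFf, ae_tendsto_outerDisk hlog] with t h1 h2
      exact h1.div h2 (outerFn_ne_zero w t)
    · filter_upwards [hlog.1] with t ht
      rw [norm_div, norm_outerFn ht]
      exact div_self ht.ne'
  · exact (mul_div_cancel₀ _ (outerFn_ne_zero w t)).symm

/-- A Hardy function lying in `L^q` belongs to `H^q`. -/
lemma mem_hardy_of_memLp {p q : ℝ≥0∞} (hp : p ≠ 0) (hq : q ≠ 0) {f : Torus → ℂ} (hf : f ∈ Hardy p)
    (hfq : MemLp f q m) : f ∈ Hardy q := by
  by_cases hf0 : f =ᵐ[m] 0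
  · exact hardy_congr (zero_mem_hardy q) hf0.symm
  · obtain ⟨hlog, J, hJ, hfJ⟩ := exists_inner_of_mem_hardy hp hf hf0
    exact hardy_congr (outerFn_mul_mem_hardy hlog hq hfq.norm hJ) hfJ.symm

/-- A product of Hardy functions lying in `L^q` belongs to `H^q`. -/
lemma mul_mem_hardy_of_memLp {p p' q : ℝ≥0∞} (hp : p ≠ 0) (hp' : p' ≠ 0) (hq : q ≠ 0)
    {f g : Torus → ℂ} (hf : f ∈ Hardy p) (hg : g ∈ Hardy p')
    (hfg : MemLp (fun t => f t * g t) q m) : (fun t => f t * g t) ∈ Hardy q := by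
  by_cases hf0 : f =ᵐ[m] 0
  · refine hardy_congr (zero_mem_hardy q) (hf0.mono fun t ht => ?_)
    simp [ht]
  by_cases hg0 : g =ᵐ[m] 0
  · refine hardy_congr (zero_mem_hardy q) (hg0.mono fun t ht => ?_)
    simp [ht]
  obtain ⟨hlf, J, hJ, hfJ⟩ := exists_inner_of_mem_hardy hp hf hf0
  obtain ⟨hlg, J', hJ', hgJ⟩ := exists_inner_of_mem_hardy hp' hg hg0
  have hw : MemLp (fun t => ‖f t‖ * ‖g t‖) q m :=
    hfg.norm.ae_eq (.of_forall fun t => by simp)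
  refine hardy_congr (outerFn_mul_mem_hardy (hlf.mul hlg) hq hw (hJ.mul hJ')) ?_
  filter_upwards [hfJ, hgJ, outerFn_mul hlf hlg] with t h1 h2 h3
  rw [h3, h1, h2]
  ring

/-! ### Fourier coefficients -/

/-- A form of dominated convergence in `L¹` with varying majorants of constant mass. -/
lemma tendsto_lintegral_enorm_sub {F : ℕ → Torus → ℂ} {f : Torus → ℂ} {G : ℕ → Torus → ℝ≥0∞}
    (hF : ∀ n, AEStronglyMeasurable (F n) m) (hf : Integrable f m)
    (hG : ∀ n, AEMeasurable (G n) m) (hFG : ∀ n, ∀ᵐ t ∂m, ‖F n t‖ₑ ≤ G n t)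
    (hGint : ∀ n, ∫⁻ t, G n t ∂m = ∫⁻ t, ‖f t‖ₑ ∂m)
    (hGlim : ∀ᵐ t ∂m, Tendsto (fun n => G n t) atTop (𝓝 ‖f t‖ₑ))
    (hFlim : ∀ᵐ t ∂m, Tendsto (fun n => F n t) atTop (𝓝 (f t))) :
    Tendsto (fun n => ∫⁻ t, ‖F n t - f t‖ₑ ∂m) atTop (𝓝 0) := by
  -- Fatou's lemma is applied to `G n + |f| - |F n - f|`, which is nonnegative
  set A := ∫⁻ t, ‖f t‖ₑ ∂m + ∫⁻ t, ‖f t‖ₑ ∂m with hA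
  have hAtop : A ≠ ∞ := ENNReal.add_ne_top.2 ⟨hf.2.ne, hf.2.ne⟩
  set d : ℕ → Torus → ℝ≥0∞ := fun n t => ‖F n t - f t‖ₑ with hd
  have hdm : ∀ n, AEMeasurable (d n) m := fun n => ((hF n).sub hf.1).enorm
  set a : ℕ → Torus → ℝ≥0∞ := fun n t => (G n t + ‖f t‖ₑ) - d n t with ha
  have ham : ∀ n, AEMeasurable (a n) m := fun n => ((hG n).add hf.1.enorm).sub (hdm n)
  have hsum : ∀ n, ∫⁻ t, a n t ∂m + ∫⁻ t, d n t ∂m = A := by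
    intro n
    have hA' : A = ∫⁻ t, (G n t + ‖f t‖ₑ) ∂m := by
      rw [lintegral_add_right' _ hf.1.enorm, hGint n]
    rw [← lintegral_add_right' _ (hdm n), hA']
    refine lintegral_congr_ae ?_
    filter_upwards [hFG n] with t ht
    refine tsub_add_cancel_of_le (enorm_sub_le.trans ?_)
    gcongr
  have hfatou : A ≤ liminf (fun n => ∫⁻ t, a n t ∂m) atTop := by
    refine le_trans (le_of_eq ?_) (lintegral_liminf_le' ham)
    rw [hA, ← lintegral_add_right' _ hf.1.enorm]
    refine lintegral_congr_ae ?_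
    filter_upwards [hGlim, hFlim] with t h1 h2
    have h3 : Tendsto (fun n => d n t) atTop (𝓝 0) := by
      have := (h2.sub_const (f t)).enorm
      simpa using this
    have h4 := ENNReal.Tendsto.sub (h1.add_const ‖f t‖ₑ) h3 (Or.inr ENNReal.zero_ne_top)
    rw [tsub_zero] at h4
    exact h4.liminf_eq.symm
  rw [ENNReal.tendsto_nhds_zero]
  intro ε hε
  rcases eq_or_ne A 0 with hA0 | hA0
  · refine .of_forall fun n => ?_
    have := hsum n
    rw [hA0, add_eq_zero] at this
    exact this.2.le.trans zero_le
  · have h5 := eventually_lt_of_lt_liminf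
      ((ENNReal.sub_lt_self hAtop hA0 hε.ne').trans_le hfatou)
    filter_upwards [h5] with n hn
    have h6 : A ≤ ∫⁻ t, a n t ∂m + ε := tsub_le_iff_right.1 hn.le
    rw [← hsum n] at h6
    have h7 : ∫⁻ t, a n t ∂m ≠ ∞ := by
      intro h
      have := hsum n
      rw [h, top_add] at this
      exact hAtop this.symm
    exact (ENNReal.add_le_add_iff_left h7).1 h6

/-- The Fourier coefficients of negative index of an `H¹` function vanish. The dilations of the
extension converge in `L¹` since they are dominated by the Poisson integrals of `|f|`. -/
theorem integral_pt_pow_mul_eq_zero {f : Torus → ℂ} (hf : f ∈ Hardy 1) (k : ℕ) :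
    ∫ t, pt t ^ (k + 1) * f t ∂m = 0 := by
  by_cases hf0 : f =ᵐ[m] 0
  · refine integral_eq_zero_of_ae (hf0.mono fun t ht => ?_)
    simp [ht]
  have hfi : Integrable f m := memLp_one_iff_integrable.1 (memLp_of_mem_hardy hf)
  obtain ⟨F, hF, hFf⟩ := hf
  obtain ⟨z₀, hz₀, hne⟩ := exists_ne_zero_of_boundary hFf hf0
  obtain ⟨hlog, hle⟩ := hF.norm_le_exp_poisson_log one_ne_zero hFf hz₀ hne
  have hexp : (fun t => Real.exp (Real.log ‖f t‖)) =ᵐ[m] fun t => ‖f t‖ :=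
    hlog.1.mono fun t ht => Real.exp_log ht
  have hle' : ∀ z ∈ ball (0 : ℂ) 1, ‖F z‖ ≤ poisson (fun t => ‖f t‖) z := fun z hz =>
    ((hle z hz).trans (exp_poisson_le hlog.2 (hfi.norm.congr hexp.symm) hz)).trans_eq
      (integral_congr_ae (hexp.mono fun t ht => by simp only [ht]))
  have hFm : ∀ n, Continuous fun t : Torus => F (radius n * pt t) := fun n =>
    continuous_dilate hF.1 (radius_mem n)
  have hpm : ∀ n, AEMeasurable (fun t : Torus =>
      ENNReal.ofReal (poisson (fun t => ‖f t‖) (radius n * pt t))) m := by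
    intro n
    have h1 := continuous_dilate (differentiableOn_herglotz hfi.norm.ofReal) (radius_mem n)
    refine (Complex.continuous_re.comp h1).measurable.ennreal_ofReal.aemeasurable.congr ?_
    exact .of_forall fun t => by
      have := re_herglotz (mul_pt_mem_ball (radius_mem n) t) hfi.norm
      exact congrArg ENNReal.ofReal this
  have hL1 := tendsto_lintegral_enorm_sub (F := fun n t => F (radius n * pt t)) (f := f)
    (fun n => (hFm n).aestronglyMeasurable) hfi hpm
    (fun n => .of_forall fun t => by
      rw [← ofReal_norm]
      exact ENNReal.ofReal_le_ofReal (hle' _ (mul_pt_mem_ball (radius_mem n) t)))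
    (fun n => by
      rw [lintegral_poisson hfi.norm (.of_forall fun t => norm_nonneg _) (radius_mem n)]
      simp only [ofReal_norm])
    (by
      filter_upwards [ae_tendsto_poisson_real hfi.norm] with t ht
      have h1 := ht.comp ((tendsto_radial t).comp tendsto_radius)
      have h2 := (ENNReal.continuous_ofReal.tendsto _).comp h1
      rw [ofReal_norm] at h2
      exact h2)
    (hFf.mono fun t ht => tendsto_dilate ht)
  have hmulm : ∀ u : Torus → ℂ, Integrable u m → Integrable (fun t => pt t ^ (k + 1) * u t) m :=
    fun u hu => hu.bdd_mul (c := 1) (continuous_pt.pow _).aestronglyMeasurable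
      (.of_forall fun t => by simp)
  have hFi : ∀ n, Integrable (fun t : Torus => F (radius n * pt t)) m := fun n =>
    (hFm n).integrable_of_hasCompactSupport (HasCompactSupport.of_compactSpace _)
  have hlim := tendsto_integral_of_L1 (μ := m) (l := atTop) (fun t => pt t ^ (k + 1) * f t)
    (hmulm f hfi).1 (F := fun n t => pt t ^ (k + 1) * F (radius n * pt t))
    (.of_forall fun n => hmulm _ (hFi n))
    (by
      refine hL1.congr fun n => lintegral_congr fun t => ?_
      rw [← mul_sub, enorm_mul]
      simp [← ofReal_norm (pt t)])
  have hzero : ∀ n, ∫ t, pt t ^ (k + 1) * F (radius n * pt t) ∂m = 0 := by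
    intro n
    have h0 : (0 : ℂ) ∈ ball (0 : ℂ) 1 := by simp
    have hD : DiffContOnCl ℂ (fun z : ℂ => z ^ (k + 1) • F (radius n * z)) (ball 0 1) :=
      (by fun_prop : Differentiable ℂ fun z : ℂ => z ^ (k + 1)).diffContOnCl.smul
        (diffContOnCl_dilate hF.1 (radius_mem n))
    have h1 := poisson_of_diffContOnCl hD h0
    simpa [poisson, pk, div_self (pt_ne_zero _)] using h1
  simp only [hzero] at hlim
  exact (tendsto_nhds_unique hlim tendsto_const_nhds)

/-- An integrable function without Fourier coefficients of negative index is in `H¹`: its Poisson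
integral is holomorphic. -/
theorem mem_hardy_one_of_integral_pt_pow_mul {f : Torus → ℂ} (hf : Integrable f m)
    (h : ∀ k : ℕ, ∫ t, pt t ^ (k + 1) * f t ∂m = 0) : f ∈ Hardy 1 := by
  have hP : ∀ z ∈ ball (0 : ℂ) 1, poisson f z = (herglotz f z + ∫ t, f t ∂m) / 2 := by
    intro z hz
    have hz1 : ‖z‖ < 1 := by simpa using hz
    -- the conjugate kernel is a power series in `pt t`, so only its constant term contributes
    have hgeo : ∫ t, (1 - pt t * conj z)⁻¹ * f t ∂m = ∫ t, f t ∂m := by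
      have hint : ∀ n : ℕ, Integrable (fun t => (pt t * conj z) ^ n * f t) m := fun n =>
        hf.bdd_mul (c := ‖z‖ ^ n) (by fun_prop : Continuous fun t =>
          (pt t * conj z) ^ n).aestronglyMeasurable (.of_forall fun t => by simp)
      have hs := hasSum_integral_of_summable_integral_norm hint (by
        have : ∀ n : ℕ, ∫ t, ‖(pt t * conj z) ^ n * f t‖ ∂m = ‖z‖ ^ n * ∫ t, ‖f t‖ ∂m := by
          intro n
          rw [← integral_const_mul]
          simp
        simp only [this]
        exact (summable_geometric_of_lt_one (norm_nonneg z) hz1).mul_right _)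
      have h1 : ∀ t, ∑' n : ℕ, (pt t * conj z) ^ n * f t = (1 - pt t * conj z)⁻¹ * f t := by
        intro t
        rw [tsum_mul_right, tsum_geometric_of_norm_lt_one (by simpa using hz1)]
      simp only [h1] at hs
      refine hs.unique ?_
      have h2 := hasSum_single (f := fun n : ℕ => ∫ t, (pt t * conj z) ^ n * f t ∂m) 0
        fun n hn => by
          obtain ⟨k, rfl⟩ := Nat.exists_eq_succ_of_ne_zero hn
          have : ∀ t, (pt t * conj z) ^ k.succ * f t =
              conj z ^ (k + 1) * (pt t ^ (k + 1) * f t) := fun t => by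
            rw [Nat.succ_eq_add_one]; ring
          simp only [this]
          rw [integral_const_mul, h k, mul_zero]
      simpa using h2
    have hne : ∀ t, 1 - pt t * conj z ≠ 0 := by
      intro t h0
      have h1 : ‖pt t * conj z‖ = 1 := by rw [← sub_eq_zero.1 h0, norm_one]
      simp only [norm_mul, norm_pt, one_mul, RCLike.norm_conj] at h1
      linarith
    have hk : ∀ t, pk z t • f t = (1 / 2) * ((pt t + z) / (pt t - z) * f t) +
        ((1 - pt t * conj z)⁻¹ * f t - (1 / 2) * f t) := by
      intro t
      have h1 : ((pk z t : ℝ) : ℂ) = ((pt t + z) / (pt t - z) +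
          conj ((pt t + z) / (pt t - z))) / 2 := Complex.re_eq_add_conj _
      have h2 : conj ((pt t + z) / (pt t - z)) = 2 * (1 - pt t * conj z)⁻¹ - 1 := by
        have h3 := hne t
        have h4 := pt_ne_zero t
        rw [map_div₀, map_add, map_sub, conj_pt]
        have h5 : (pt t)⁻¹ - conj z ≠ 0 := by
          intro h6
          apply h3
          rw [← sub_eq_zero.1 h6, mul_inv_cancel₀ h4, sub_self]
        field_simp
        ring
      rw [Complex.real_smul, h1, h2]
      ring
    have hi1 : Integrable (fun t => (1 - pt t * conj z)⁻¹ * f t) m := by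
      have hc : Continuous fun t => (1 - pt t * conj z)⁻¹ :=
        (by fun_prop : Continuous fun t => 1 - pt t * conj z).inv₀ hne
      obtain ⟨C, hC⟩ := isCompact_univ.exists_bound_of_continuousOn hc.continuousOn
      exact hf.bdd_mul (c := C) hc.aestronglyMeasurable (.of_forall fun t => hC t trivial)
    have hi2 := integrable_herglotz hz hf
    have hi3 : Integrable (fun t => (1 - pt t * conj z)⁻¹ * f t - (1 / 2) * f t) m :=
      hi1.sub (hf.const_mul _)
    simp only [poisson, hk]
    rw [integral_add (hi2.const_mul _) hi3,
      integral_sub hi1 (hf.const_mul _), integral_const_mul, integral_const_mul, hgeo, herglotz]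
    ring
  refine ⟨fun z => (herglotz f z + ∫ t, f t ∂m) / 2,
    ⟨((differentiableOn_herglotz hf).add_const _).div_const 2, lt_of_le_of_lt
      (iSup₂_le fun r hr => ?_) hf.2⟩, ?_⟩
  · rw [eLpNorm_one_eq_lintegral_enorm]
    calc _ ≤ ∫⁻ s, ENNReal.ofReal (poisson (fun t => ‖f t‖) (r * pt s)) ∂m := by
          refine lintegral_mono fun s => ?_
          have hz := mul_pt_mem_ball hr s
          dsimp only
          rw [← hP _ hz, ← ofReal_norm]
          exact ENNReal.ofReal_le_ofReal (norm_poisson_le hz f)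
      _ = ∫⁻ t, ‖f t‖ₑ ∂m := by
          rw [lintegral_poisson hf.norm (.of_forall fun t => norm_nonneg _) hr]
          simp only [ofReal_norm]
  · filter_upwards [ae_tendsto_poisson hf] with t ht
    refine ht.congr' ?_
    filter_upwards [ball_mem_nontangential (pt t)] with z hz using hP z hz


/-! ### Toeplitz kernels -/

lemma rieszProj_eq_zero_iff {h : Torus → ℂ} :
    (∀ z ∈ ball (0 : ℂ) 1, rieszProj h z = 0) ↔ ∀ n : ℕ, fourierCoeff h n = 0 := by
  refine ⟨fun H n => ?_, fun H z _ => by simp [rieszProj, H]⟩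
  have hbd : ∀ n : ℤ, ‖fourierCoeff h n‖ ≤ ∫ t, ‖h t‖ ∂m := fun n =>
    (norm_integral_le_integral_norm _).trans_eq (integral_congr_ae (.of_forall fun t => by
      simp only [norm_smul, fourier_eq_pt_zpow, norm_zpow, norm_pt, one_zpow, one_mul]))
  have hps : HasFPowerSeriesAt (fun _ : ℂ => (0 : ℂ))
      (FormalMultilinearSeries.ofScalars ℂ fun n : ℕ => fourierCoeff h n) 0 := by
    rw [hasFPowerSeriesAt_iff]
    filter_upwards [isOpen_ball.mem_nhds (mem_ball_self (x := (0 : ℂ)) one_pos)] with z hz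
    have hz1 : ‖z‖ < 1 := by simpa using hz
    have hsum : Summable fun n : ℕ => fourierCoeff h n * z ^ n := by
      refine Summable.of_norm_bounded
        ((summable_geometric_of_lt_one (norm_nonneg z) hz1).mul_left (∫ t, ‖h t‖ ∂m)) fun n => ?_
      rw [norm_mul, norm_pow]
      gcongr
      exact hbd n
    have := hsum.hasSum
    rw [show ∑' n : ℕ, fourierCoeff h n * z ^ n = 0 from H z hz] at this
    simpa [FormalMultilinearSeries.coeff_ofScalars, mul_comm] using this
  exact congrFun ((FormalMultilinearSeries.ofScalars_series_eq_zero ℂ).1 hps.eq_zero) n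

lemma exists_ae_bound {φ : Torus → ℂ} (hφ : MemLp φ ∞ m) : ∃ C, ∀ᵐ t ∂m, ‖φ t‖ ≤ C := by
  refine ⟨(eLpNorm φ ∞ m).toReal, ?_⟩
  filter_upwards [ae_le_eLpNormEssSup (f := φ) (μ := m)] with t ht
  rw [← toReal_enorm]
  exact ENNReal.toReal_mono hφ.2.ne (by simpa using ht)

/-- A function of modulus `|φ| |u|`, with `φ` bounded and `u ∈ L^q`, is in `L^q`. -/
lemma memLp_of_norm_eq_mul {E E' : Type*} [NormedAddCommGroup E] [NormedAddCommGroup E']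
    {φ : Torus → ℂ} (hφ : MemLp φ ∞ m) {q : ℝ≥0∞} {u : Torus → E} (hu : MemLp u q m)
    {v : Torus → E'} (hv : AEStronglyMeasurable v m) (h : ∀ᵐ t ∂m, ‖v t‖ = ‖φ t‖ * ‖u t‖) :
    MemLp v q m := by
  obtain ⟨C, hC⟩ := exists_ae_bound hφ
  refine hu.of_le_mul (c := C) hv ?_
  filter_upwards [h, hC] with t h1 h2
  rw [h1]
  gcongr

/-- `f ∈ K_p(φ)` means that `f` and the conjugate of `z φ f` both lie in `H^p`. -/
theorem mem_toeplitzKer_iff {p : ℝ≥0∞} (hp : 1 ≤ p) {φ : Torus → ℂ} (hφ : MemLp φ ∞ m)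
    {f : Torus → ℂ} :
    f ∈ toeplitzKer p φ ↔
      f ∈ Hardy p ∧ (fun t => conj (pt t) * conj (φ t) * conj (f t)) ∈ Hardy p := by
  refine and_congr_right fun hf => ?_
  have hp0 : p ≠ 0 := (one_pos.trans_le hp).ne'
  have hfp := memLp_of_mem_hardy hf
  have hk : MemLp (fun t => conj (pt t) * conj (φ t) * conj (f t)) p m := by
    refine memLp_of_norm_eq_mul hφ hfp ?_ (.of_forall fun t => by simp)
    exact ((Complex.continuous_conj.comp continuous_pt).aestronglyMeasurable.mul
      (Complex.continuous_conj.comp_aestronglyMeasurable hφ.1)).mul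
      (Complex.continuous_conj.comp_aestronglyMeasurable hfp.1)
  have hcoeff : ∀ n : ℕ, ∫ t, pt t ^ (n + 1) * (conj (pt t) * conj (φ t) * conj (f t)) ∂m =
      conj (fourierCoeff (fun t => φ t * f t) n) := by
    intro n
    rw [fourierCoeff, ← integral_conj]
    refine integral_congr_ae (.of_forall fun t => ?_)
    have h0 := pt_ne_zero t
    simp only [smul_eq_mul, map_mul, fourier_eq_pt_zpow, map_zpow₀, conj_pt, inv_zpow', neg_neg,
      zpow_natCast]
    field_simp
    ring
  rw [show (∀ z ∈ ball (0 : ℂ) 1, toeplitz φ f z = 0) ↔ _ from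
    rieszProj_eq_zero_iff (h := fun t => φ t * f t)]
  constructor
  · intro H
    refine mem_hardy_of_memLp one_ne_zero hp0 (mem_hardy_one_of_integral_pt_pow_mul
      (hk.integrable hp) fun n => ?_) hk
    rw [hcoeff, H, map_zero]
  · intro H n
    have h1 := integral_pt_pow_mul_eq_zero
      (mem_hardy_of_memLp hp0 one_ne_zero H (hk.mono_exponent hp)) n
    rw [hcoeff] at h1
    simpa using h1

/-! ### Moduli of functions in a Toeplitz kernel -/

lemma memLp_sqrt {p : ℝ≥0∞} {g : Torus → ℝ} (hg : MemLp g (p / 2) m) (hg0 : 0 ≤ᵐ[m] g) :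
    MemLp (fun t => √(g t)) p m := by
  have h := hg.norm_rpow_div (1 / 2 : ℝ≥0∞)
  have e : p / 2 / (1 / 2) = p := by
    rw [one_div, ENNReal.div_eq_inv_mul, inv_inv, ENNReal.mul_div_cancel two_ne_zero
      ENNReal.ofNat_ne_top]
  rw [e] at h
  refine h.ae_eq ?_
  filter_upwards [hg0] with t ht
  rw [Real.norm_eq_abs, abs_of_nonneg ht, Real.sqrt_eq_rpow]
  simp

lemma ae_ne_zero_of_mem_hardy {q : ℝ≥0∞} (hq : q ≠ 0) {f : Torus → ℂ} (hf : f ∈ Hardy q)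
    (hf0 : ¬ f =ᵐ[m] 0) : ∀ᵐ t ∂m, f t ≠ 0 :=
  (exists_inner_of_mem_hardy hq hf hf0).1.1.mono fun _ ht => norm_pos_iff.1 ht

/-- A symbol with a nontrivial Toeplitz kernel has a log-integrable modulus. -/
lemma logIntegrable_symbol {p : ℝ≥0∞} (hp : 1 ≤ p) {φ : Torus → ℂ} (hφ : MemLp φ ∞ m)
    (hφ0 : ¬ φ =ᵐ[m] 0) (hK : ∃ f ∈ toeplitzKer p φ, ¬ f =ᵐ[m] 0) :
    LogIntegrable fun t => ‖φ t‖ := by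
  have hp0 : p ≠ 0 := (one_pos.trans_le hp).ne'
  obtain ⟨f, hf, hf0⟩ := hK
  obtain ⟨h1, h2⟩ := (mem_toeplitzKer_iff hp hφ).1 hf
  have hfne := ae_ne_zero_of_mem_hardy hp0 h1 hf0
  have hlf := (exists_inner_of_mem_hardy hp0 h1 hf0).1
  have hlk := (exists_inner_of_mem_hardy hp0 h2 fun h => hφ0 (by
    filter_upwards [h, hfne] with t ht1 ht2
    simpa [pt_ne_zero, ht2] using ht1)).1
  refine (hlk.mul hlf.inv).congr ?_
  filter_upwards [hfne] with t ht
  have : ‖f t‖ ≠ 0 := norm_ne_zero_iff.2 ht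
  simp [this]

/-- An inner factor of `G` is the quotient of `G` by the outer function with modulus `|G|`, up to
a unimodular constant. -/
lemma IsInnerFactor.exists_eq {I G : Torus → ℂ} (h : IsInnerFactor I G) :
    LogIntegrable (fun t => ‖G t‖) ∧
      ∃ c : ℂ, ‖c‖ = 1 ∧ G =ᵐ[m] fun t => I t * (c * outerFn (fun s => ‖G s‖) t) := by
  obtain ⟨hI, O, ⟨c, hc, w, hw, hO⟩, hG⟩ := h
  have hwG : w =ᵐ[m] fun t => ‖G t‖ := by
    filter_upwards [hG, hO, hI.2, hw.1] with t h1 h2 h3 h4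
    rw [h1, h2, norm_mul, norm_mul, h3, hc, norm_outerFn h4, one_mul, one_mul]
  refine ⟨hw.congr hwG, c, hc, ?_⟩
  filter_upwards [hG, hO, outerFn_congr hwG] with t h1 h2 h3
  rw [h1, h2, h3]

/-- The case of a non-null `g`: the functions in the kernel with modulus `√g` are the products of
the outer function of modulus `√g` with the divisors of the inner factor. -/
theorem mem_toeplitzKer_iff_exists_isInnerDivisor {p : ℝ≥0∞} (hp : 1 ≤ p) {φ : Torus → ℂ}
    (hφ : MemLp φ ∞ m) (hlφ : LogIntegrable fun t => ‖φ t‖) {g : Torus → ℝ}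
    (hg0 : 0 ≤ᵐ[m] g) (hg : MemLp g (p / 2) m) (hlg : LogIntegrable g) {I : Torus → ℂ}
    (hI : IsInnerFactor I fun t => conj (pt t) * conj (φ t) * (g t : ℂ)) (f : Torus → ℂ) :
    (f ∈ toeplitzKer p φ ∧ (fun t => ‖f t‖ ^ 2) =ᵐ[m] g) ↔
      ∃ J, IsInnerDivisor J I ∧ f =ᵐ[m] fun t => outerFn (fun s => √(g s)) t * J t := by
  have hp0 : p ≠ 0 := (one_pos.trans_le hp).ne'
  obtain ⟨-, c, hc, hG⟩ := hI.exists_eq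
  have hc0 : c ≠ 0 := norm_ne_zero_iff.1 (by rw [hc]; exact one_ne_zero)
  have hcc : conj c * c = 1 := by
    rw [mul_comm, Complex.mul_conj, Complex.normSq_eq_norm_sq, hc]; simp
  -- the outer factor of `z̄ φ̄ g` splits as `O_{|φ| √g} O_{√g}`
  have hsplit : (fun t => conj (pt t) * conj (φ t) * (g t : ℂ)) =ᵐ[m] fun t =>
      I t * (c * (outerFn (fun s => ‖φ s‖ * √(g s)) t * outerFn (fun s => √(g s)) t)) := by
    have hw : (fun t => ‖conj (pt t) * conj (φ t) * (g t : ℂ)‖) =ᵐ[m]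
        fun t => ‖φ t‖ * √(g t) * √(g t) := by
      filter_upwards [hg0] with t ht
      rw [mul_assoc ‖φ t‖, Real.mul_self_sqrt ht]
      simp [abs_of_nonneg (show 0 ≤ g t from ht)]
    filter_upwards [hG, outerFn_congr hw, outerFn_mul (hlφ.mul hlg.sqrt) hlg.sqrt]
      with t h1 h2 h3
    rw [h1, h2, h3]
  have hsq := memLp_sqrt hg hg0
  have hφsq : MemLp (fun t => ‖φ t‖ * √(g t)) p m :=
    memLp_of_norm_eq_mul hφ hsq (hφ.1.norm.mul hsq.1) (.of_forall fun t => by simp)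
  rw [mem_toeplitzKer_iff hp hφ]
  constructor
  · rintro ⟨⟨hf, hk⟩, hfg⟩
    have hfs : (fun t => ‖f t‖) =ᵐ[m] fun t => √(g t) := by
      filter_upwards [hfg] with t ht
      rw [← ht, Real.sqrt_sq (norm_nonneg _)]
    have hks : (fun t => ‖conj (pt t) * conj (φ t) * conj (f t)‖) =ᵐ[m]
        fun t => ‖φ t‖ * √(g t) := by
      filter_upwards [hfs] with t ht
      simp [ht]
    have hf0 : ¬ f =ᵐ[m] 0 := fun h => by
      obtain ⟨t, h1, h2, h3⟩ := (h.and (hfg.and hlg.1)).exists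
      simp only [h1, Pi.zero_apply, norm_zero] at h2
      norm_num at h2
      exact h3.ne h2
    have hk0 : ¬ (fun t => conj (pt t) * conj (φ t) * conj (f t)) =ᵐ[m] 0 := fun h => by
      obtain ⟨t, h1, h2, h3⟩ := (h.and (hks.and (hlφ.mul hlg.sqrt).1)).exists
      simp only at h1 h2
      rw [h1] at h2
      simp only [Pi.zero_apply, norm_zero] at h2
      exact h3.ne h2
    obtain ⟨-, J, hJ, hfJ⟩ := exists_inner_of_mem_hardy hp0 hf hf0
    obtain ⟨-, J', hJ', hkJ⟩ := exists_inner_of_mem_hardy hp0 hk hk0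
    -- `c I = J J'`, so the unimodular constant is absorbed into the complementary divisor
    have hcJ' : IsInner fun t => conj c * J' t :=
      (isInner_const (c := conj c) (by simpa using hc)).mul hJ'
    refine ⟨J, ⟨hJ, _, hcJ', ?_⟩, ?_⟩
    · filter_upwards [hsplit, hfJ, hkJ, outerFn_congr hfs, outerFn_congr hks, hfg]
        with t h1 h2 h3 h4 h5 h6
      have hO := outerFn_ne_zero (fun s => ‖φ s‖ * √(g s)) t
      have hO' := outerFn_ne_zero (fun s => √(g s)) t
      have hfact : conj (pt t) * conj (φ t) * (g t : ℂ) =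
          conj (pt t) * conj (φ t) * conj (f t) * f t := by
        rw [← h6, mul_assoc _ (conj (f t)), mul_comm (conj (f t)), Complex.mul_conj,
          Complex.normSq_eq_norm_sq]
      rw [h4] at h2
      rw [hfact, h3, h5, h2] at h1
      refine mul_left_cancel₀ (mul_ne_zero hc0 (mul_ne_zero hO hO')) ?_
      linear_combination -h1 - J t * J' t * outerFn (fun s => ‖φ s‖ * √(g s)) t *
        outerFn (fun s => √(g s)) t * hcc
    · filter_upwards [hfJ, outerFn_congr hfs] with t h1 h2
      rw [h1, h2]
  · rintro ⟨J, ⟨hJ, J', hJ', hIJ⟩, hfJ⟩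
    have hfs : ∀ᵐ t ∂m, ‖f t‖ = √(g t) := by
      filter_upwards [hfJ, hJ.2, hlg.1] with t h1 h2 h3
      rw [h1, norm_mul, h2, norm_outerFn (w := fun s => √(g s)) (Real.sqrt_pos.2 h3), mul_one]
    have hfg : (fun t => ‖f t‖ ^ 2) =ᵐ[m] g := by
      filter_upwards [hfs, hg0] with t h1 h2
      rw [h1, Real.sq_sqrt h2]
    refine ⟨⟨hardy_congr (outerFn_mul_mem_hardy hlg.sqrt hp0 hsq hJ) hfJ.symm, ?_⟩, hfg⟩
    have hcJ' : IsInner fun t => c * J' t := (isInner_const hc).mul hJ'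
    refine hardy_congr (outerFn_mul_mem_hardy (hlφ.mul hlg.sqrt) hp0 hφsq hcJ') ?_
    filter_upwards [hsplit, hfJ, hIJ, hfg, hfs, hlg.1] with t h1 h2 h3 h4 h5 h6
    have hf0 : f t ≠ 0 := norm_pos_iff.1 (by rw [h5]; exact Real.sqrt_pos.2 h6)
    have hfact : conj (pt t) * conj (φ t) * (g t : ℂ) =
        conj (pt t) * conj (φ t) * conj (f t) * f t := by
      rw [← h4, mul_assoc _ (conj (f t)), mul_comm (conj (f t)), Complex.mul_conj,
        Complex.normSq_eq_norm_sq]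
    refine mul_right_cancel₀ hf0 ?_
    rw [← hfact, h1, h3, h2]
    ring

end ToeplitzKernel

theorem theorem1 (p : ℝ≥0∞) (hp : 1 ≤ p)
    (φ : ToeplitzKernel.Torus → ℂ) (hφ : MemLp φ ∞ ToeplitzKernel.m)
    (hφ0 : ¬ φ =ᵐ[ToeplitzKernel.m] 0)
    (hK : ∃ f ∈ ToeplitzKernel.toeplitzKer p φ, ¬ f =ᵐ[ToeplitzKernel.m] 0)
    (g : ToeplitzKernel.Torus → ℝ) (hg0 : 0 ≤ᵐ[ToeplitzKernel.m] g)
    (hg : MemLp g (p / 2) ToeplitzKernel.m) :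
    ((∃ f ∈ ToeplitzKernel.toeplitzKer p φ, (fun t => ‖f t‖ ^ 2) =ᵐ[ToeplitzKernel.m] g) ↔
      (fun t => conj (ToeplitzKernel.pt t) * conj (φ t) * (g t : ℂ)) ∈
        ToeplitzKernel.Hardy (p / 2)) ∧
    ((fun t => conj (ToeplitzKernel.pt t) * conj (φ t) * (g t : ℂ)) ∈
        ToeplitzKernel.Hardy (p / 2) →
      ¬ g =ᵐ[ToeplitzKernel.m] 0 →
      ToeplitzKernel.LogIntegrable (fun t => √(g t)) ∧
      (∃ I, ToeplitzKernel.IsInnerFactor I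
        (fun t => conj (ToeplitzKernel.pt t) * conj (φ t) * (g t : ℂ))) ∧
      ∀ I, ToeplitzKernel.IsInnerFactor I
          (fun t => conj (ToeplitzKernel.pt t) * conj (φ t) * (g t : ℂ)) →
        ∀ f : ToeplitzKernel.Torus → ℂ,
          (f ∈ ToeplitzKernel.toeplitzKer p φ ∧
            (fun t => ‖f t‖ ^ 2) =ᵐ[ToeplitzKernel.m] g) ↔
          ∃ J, ToeplitzKernel.IsInnerDivisor J I ∧
            f =ᵐ[ToeplitzKernel.m]
              fun t => ToeplitzKernel.outerFn (fun s => √(g s)) t * J t) := by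
  open ToeplitzKernel in
  have hp0 : p ≠ 0 := (one_pos.trans_le hp).ne'
  have hp2 : p / 2 ≠ 0 := (ENNReal.div_pos hp0 ENNReal.ofNat_ne_top).ne'
  have hlφ := logIntegrable_symbol hp hφ hφ0 hK
  have hGm : MemLp (fun t => conj (pt t) * conj (φ t) * (g t : ℂ)) (p / 2) m := by
    refine memLp_of_norm_eq_mul hφ hg ?_ (.of_forall fun t => by simp)
    exact ((Complex.continuous_conj.comp continuous_pt).aestronglyMeasurable.mul
      (Complex.continuous_conj.comp_aestronglyMeasurable hφ.1)).mul
      (Complex.continuous_ofReal.comp_aestronglyMeasurable hg.1)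
  have hmain : (fun t => conj (pt t) * conj (φ t) * (g t : ℂ)) ∈ Hardy (p / 2) →
      ¬ g =ᵐ[m] 0 → LogIntegrable g ∧
        ∃ I, IsInnerFactor I fun t => conj (pt t) * conj (φ t) * (g t : ℂ) := by
    intro hG hgne
    obtain ⟨hlG, I, hI, hGI⟩ := exists_inner_of_mem_hardy hp2 hG fun h => hgne (by
      filter_upwards [h, hlφ.1] with t h1 h2
      simpa [pt_ne_zero, norm_pos_iff.1 h2] using h1)
    refine ⟨(hlG.mul hlφ.inv).congr ?_, I, hI, _, ⟨1, norm_one, _, hlG, .rfl⟩, ?_⟩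
    · filter_upwards [hg0, hlφ.1] with t h1 h2
      have : |g t| = g t := abs_of_nonneg h1
      simp only [norm_mul, RCLike.norm_conj, norm_pt, one_mul, Complex.norm_real,
        Real.norm_eq_abs, this]
      rw [mul_comm ‖φ t‖, mul_assoc, mul_inv_cancel₀ h2.ne', mul_one]
    · filter_upwards [hGI] with t ht
      rw [ht]
      ring
  refine ⟨⟨?_, fun hG => ?_⟩, fun hG hgne => ?_⟩
  · rintro ⟨f, hf, hfg⟩
    obtain ⟨h1, h2⟩ := (mem_toeplitzKer_iff hp hφ).1 hf
    have hae : (fun t => conj (pt t) * conj (φ t) * (g t : ℂ)) =ᵐ[m]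
        fun t => conj (pt t) * conj (φ t) * conj (f t) * f t := by
      filter_upwards [hfg] with t ht
      rw [← ht, mul_assoc _ (conj (f t)), mul_comm (conj (f t)), Complex.mul_conj,
        Complex.normSq_eq_norm_sq]
    exact hardy_congr (mul_mem_hardy_of_memLp hp0 hp0 hp2 h2 h1 (hGm.ae_eq hae)) hae.symm
  · by_cases hgne : g =ᵐ[m] 0
    · refine ⟨fun _ => 0, (mem_toeplitzKer_iff hp hφ).2 ⟨zero_mem_hardy p, ?_⟩, ?_⟩
      · simpa using zero_mem_hardy p
      · filter_upwards [hgne] with t ht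
        simp [ht]
    · obtain ⟨hlg, I, hI⟩ := hmain hG hgne
      -- the trivial divisor `1` of `I` gives the outer solution
      have h1 : IsInner fun _ => (1 : ℂ) := isInner_const norm_one
      obtain ⟨h2, h3⟩ := (mem_toeplitzKer_iff_exists_isInnerDivisor hp hφ hlφ hg0 hg hlg hI _).2
        ⟨fun _ => 1, ⟨h1, I, hI.1, .of_forall fun t => (one_mul _).symm⟩, .rfl⟩
      exact ⟨_, h2, h3⟩
  · obtain ⟨hlg, hI⟩ := hmain hG hgne
    exact ⟨hlg.sqrt, hI, fun I hI f =>
      mem_toeplitzKer_iff_exists_isInnerDivisor hp hφ hlφ hg0 hg hlg hI f⟩
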